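/- **Setting.** A pure state of fixed photon number in modes $1,\dots,N$ is identified with a homogeneous polynomial in the creation operators $a_1^\dagger,\dots,a_N^\dagger$ (commuting variables); the Fock state $|n_1,\dots,n_N\rangle$ corresponds to $\prod_i \frac{1}{\sqrt{n_i!}}(a_i^\dagger)^{n_i}$. Consider $N=4+M$ modes: four target modes followed by $M$ ancilla (heralding) modes. Let $A\in\mathbb{C}^{N\times N}$ be an arbitrary matrix (not assumed unitary), acting by $a_{i,\mathrm{in}}^\dagger\mapsto\sum_j A_{ij}a_j^\dagger$. For a heralding pattern $m=(m_1,\dots,m_M)$, the (unnormalized) heralded state of an output polynomial $F$ is $$G=\frac{1}{\prod_j m_j!}\,\frac{\partial^{m_1+\dots+m_M}F}{\partial (a_5^{\dagger})^{m_1}\cdots\partial (a_{4+M}^{\dagger})^{m_M}}\bigg|_{a_5^\dagger=\dots=a_{4+M}^\dagger=0}.$$ Encode $(c,t)\in\{0,1\}^2$ in dual rail as $|c,t\rangle_L=|1-c,\,c,\,1-t,\,t\rangle$. Given an ancilla Fock input $|\nu_1,\dots,\nu_M\rangle$ and a heralding pattern $m$, let $G_{c,t}$ be the heralded polynomial obtained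 from the input $|c,t\rangle_L\otimes|\nu_1,\dots,\nu_M\rangle$, and let $Q_{c,t}$ be the polynomial of $|c,\,c\oplus t\rangle_L$. We say that $A$ and $\gamma\in\mathbb{C}$ *implement a heralded dual-rail CNOT gate* with this ancilla input and pattern if $\gamma\,G_{c,t}=Q_{c,t}$ for all four $(c,t)$, with the same $\gamma$. **Theorem.** 1. There is no heralded dual-rail CNOT gate with three photons, five modes and a single heralding photon: for $M=1$, ancilla input $|1\rangle$ and heralding pattern $(1)$, no $A\in\mathbb{C}^{5\times5}$ and $\gamma\in\mathbb{C}$ implement it. 2. In the situation of (1), let $\gamma\in\mathbb{C}$ be any fixed constant and regard the 25 entries of $A$ as variables. Let $f_1,\dots,f_{40}\in\mathbb{C}[A_{ij}]$ be the joint polynomial system of the four tasks, i.e. the coefficients of $\gamma G_{c,t}-Q_{c,t}$ at the ten degree-two monomials in $a_1^\dagger,\dots,a_4^\dagger$, for the four pairs $(c,t)$. This system has a Nullstellensatz infeasibility certificate of degree $6$: there are $\beta_1,\dots,\beta_{40}\in\mathbb{C}[A_{ij}]$ with $\sum_i\beta_i f_i=1$ and $\max_i\deg\beta_i=6$. 3.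 Hence at least two ancilla photons are needed: for every number $M\ge 0$ of ancilla modes, every ancilla Fock input $|\nu_1,\dots,\nu_M\rangle$ and every heralding pattern $(m_1,\dots,m_M)$, if some $A\in\mathbb{C}^{(4+M)\times(4+M)}$ and $\gamma\in\mathbb{C}$ implement a heralded dual-rail CNOT gate, then $\sum_j\nu_j\ge2$ and $\sum_j m_j\ge 2$. -/

import Mathlib

open MvPolynomial

noncomputable section

/-- The polynomial in the creation operators of the Fock state `|s⟩`:
`∏ i, (1 / √(s i)!) * (a i)† ^ (s i)`. The variable `X i` stands for the creation operator of
mode `i`, and a pure state of fixed photon number is identified with its creation-operator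
polynomial (applied to the vacuum). -/
def fockPoly {ι : Type*} [Fintype ι] (s : ι → ℕ) : MvPolynomial ι ℂ :=
  ∏ i, C (((Real.sqrt ((s i).factorial : ℝ) : ℝ) : ℂ)⁻¹) * X i ^ s i

/-- The polynomial `F` of the output state: the linear transformation `A` replaces the creation
operator of the input mode `i` by `∑ j, A i j • (creation operator of the output mode j)`.
No unitarity is imposed. The entries of `A` may lie in any commutative `ℂ`-algebra, so that `A` can
be a complex matrix or a matrix of unknowns. -/
def evolve {ι : Type*} [Fintype ι] {R : Type*} [CommRing R] [Algebra ℂ R]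
    (A : Matrix ι ι R) (P : MvPolynomial ι ℂ) : MvPolynomial ι R :=
  aeval (fun i => ∑ j, C (A i j) * X j) P

/-- The iterated partial derivative `∂^(m 0 + ... + m (M-1)) F / ∂ a_0^(m 0) ... ∂ a_(M-1)^(m (M-1))`
in the `M` heralding modes. -/
def heraldDeriv {τ : Type*} {M : ℕ} {R : Type*} [CommRing R] (m : Fin M → ℕ)
    (F : MvPolynomial (τ ⊕ Fin M) R) : MvPolynomial (τ ⊕ Fin M) R :=
  (List.finRange M).foldr (fun j P => (pderiv (Sum.inr j))^[m j] P) F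

/-- The polynomial `G` (in the target modes `τ`) of the unnormalized state obtained from `F` by
finding exactly `m j` photons in the heralding mode `j`, for every `j`: differentiate `m j` times in
mode `j`, divide by `∏ j, (m j)!`, and set the creation operators of the heralding modes to zero. -/
def heraldPoly {τ : Type*} {M : ℕ} {R : Type*} [CommRing R] [Algebra ℂ R] (m : Fin M → ℕ)
    (F : MvPolynomial (τ ⊕ Fin M) R) : MvPolynomial τ R :=
  (∏ j, ((m j).factorial : ℂ))⁻¹ •
    aeval (Sum.elim (fun i => (X i : MvPolynomial τ R)) (fun _ => 0)) (heraldDeriv m F)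

/-- The occupation numbers `|1 - c, c, 1 - t, t⟩` of the two dual-rail qubits in the logical basis
state with control bit `c` and target bit `t`. -/
def dualRail (c t : Bool) : Fin 4 → ℕ :=
  ![if c then 0 else 1, if c then 1 else 0, if t then 0 else 1, if t then 1 else 0]

/-- The heralded polynomial `G` for the logical input `(c, t)` in the four target modes and the Fock
state `anc` in the `M` ancilla modes, transformation `A`, heralding pattern `m` on the ancilla
modes. -/
def gatePoly {M : ℕ} {R : Type*} [CommRing R] [Algebra ℂ R]
    (A : Matrix (Fin 4 ⊕ Fin M) (Fin 4 ⊕ Fin M) R) (anc m : Fin M → ℕ) (c t : Bool) :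
    MvPolynomial (Fin 4) R :=
  heraldPoly m (evolve A (fockPoly (Sum.elim (dualRail c t) anc)))

/-- `A` with the scalar `γ` solves the four simultaneous tasks `γ G = Q` of the heralded dual-rail
CNOT gate, with ancilla input `anc` and heralding pattern `m`: the logical input `(c, t)` is sent to
the logical output `(c, c xor t)`, with one `γ` for all four. (`γ ≠ 0` is then automatic.) -/
def IsHeraldedCNOT {M : ℕ} (A : Matrix (Fin 4 ⊕ Fin M) (Fin 4 ⊕ Fin M) ℂ) (γ : ℂ)
    (anc m : Fin M → ℕ) : Prop :=
  ∀ c t : Bool, C γ * gatePoly A anc m c t = fockPoly (dualRail c (xor c t))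

/-- The unknown `5 × 5` transformation: its entries are 25 independent variables. -/
abbrev unknownMatrix : Matrix (Fin 4 ⊕ Fin 1) (Fin 4 ⊕ Fin 1)
    (MvPolynomial ((Fin 4 ⊕ Fin 1) × (Fin 4 ⊕ Fin 1)) ℂ) :=
  Matrix.mvPolynomialX (Fin 4 ⊕ Fin 1) (Fin 4 ⊕ Fin 1) ℂ

/-- The polynomial system, in the 25 entries of the unknown matrix, of the four tasks `γ G = Q` with
one ancilla photon and heralding pattern `(1)`: for each logical input `(c, t)` and each
degree-two monomial `e` in the four creation operators, the difference of the coefficients of `e` on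
the two sides. (Both sides are homogeneous of degree two.) -/
def cnotSystem (γ : ℂ) :
    (Bool × Bool) × (Finset.finsuppAntidiag (Finset.univ : Finset (Fin 4)) 2) →
      MvPolynomial ((Fin 4 ⊕ Fin 1) × (Fin 4 ⊕ Fin 1)) ℂ :=
  fun p =>
    C γ * coeff p.2.1 (gatePoly unknownMatrix (fun _ => 1) (fun _ => 1) p.1.1 p.1.2) -
      C (coeff p.2.1 (fockPoly (dualRail p.1.1 (xor p.1.1 p.1.2))))

/-- The family `f` has a Nullstellensatz certificate `1 = ∑ i, β i * f i` of degree `d`, where the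
degree of a certificate is the largest total degree of a multiplier `β i`. -/
def HasNullstellensatzCertificate {κ σ : Type*} [Fintype κ] (f : κ → MvPolynomial σ ℂ) (d : ℕ) :
    Prop :=
  ∃ β : κ → MvPolynomial σ ℂ,
    ∑ i, β i * f i = 1 ∧ Finset.univ.sup (fun i => (β i).totalDegree) = d

end

/-! With one ancilla photon and one heralding photon, the product rule gives the heralded state `α l
b + β l a + c a b` (`gatePoly_single`): `a`, `b`, `l` are the control, target and ancilla rows as
linear forms in the target modes, and `α`, `β`, `c` are their entries in the heralding column. The
factor `γ` is absorbed into `l` and `c`. In the basis `X 2 ± X 3` of the target qubit the CNOT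
becomes a sign gate: four such forms `g i j` equal `± xᵢ yⱼ`, with the minus sign only at `(2, 2)`.
Identically `g 1 2 * g 2 1 - g 1 1 * g 2 2 = l² m n` with `m = α₂ a₁ - α₁ a₂` and `n = β₂ b₁ - β₁
b₂`, so a gate would force `l² m n = 2 x₁ x₂ y₁ y₂`. The right side is nonzero and squarefree, so
the linear form `l` can be neither zero nor nonzero.

The certificate makes this effective. Polarization turns relations between forms into ring
identities between their values, and `certSpan f d` keeps track of the degree of the multipliers.
Eliminations between the gate relations cost degree 1 to 3; `eight_mul_l_p₁` combines them into a
degree 4 certificate for a value of `l`, and symmetry gives the values at the other dual points.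
Modulo `l`, the relation `star` contradicts the gate relations (`four_eq`); the values of `l` enter
there with quadratic coefficients, whence 4 + 2 = 6.

Evaluating the certificate at a matrix excludes the five-mode gate. In general, homogeneity forces
as many heralding photons as ancilla photons, and the cases of zero or one photon reduce to five
modes. -/

/-! ### Polarized products of linear forms. -/

section Polarization

variable {ι R : Type*} [CommRing R]

/-- The polarization of a product of two linear forms. -/
def sym2 (f g : ι → R) (i j : ι) : R := f i * g j + f j * g i

/-- The polarization of a product of three linear forms. -/
def sym3 (f g h : ι → R) (i j k : ι) : R :=
  f i * sym2 g h j k + f j * sym2 g h i k + f k * sym2 g h i j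

/-- The polarization of a product of four linear forms. -/
def sym4 (f g h u : ι → R) (i j k m : ι) : R :=
  f i * sym3 g h u j k m + f j * sym3 g h u i k m + f k * sym3 g h u i j m + f m * sym3 g h u i j k

/-- The polarization of the quadratic form `α * l * b + β * l * a + c * a * b`. -/
def gateForm (α β c : R) (a b l : ι → R) (i j : ι) : R :=
  α * sym2 l b i j + β * sym2 l a i j + c * sym2 a b i j

end Polarization

/-! ### Certificates with bounded multiplier degree. -/

section Certificates

variable {κ σ : Type*} [Fintype κ]

/-- The polynomials `∑ i, β i * f i` with all multipliers `β i` of total degree at most `d`. -/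
def certSpan (f : κ → MvPolynomial σ ℂ) (d : ℕ) : Submodule ℂ (MvPolynomial σ ℂ) where
  carrier := {p | ∃ β : κ → MvPolynomial σ ℂ,
    (∀ i, β i ∈ restrictTotalDegree σ ℂ d) ∧ ∑ i, β i * f i = p}
  zero_mem' := ⟨0, fun _ => zero_mem _, by simp⟩
  add_mem' := by
    rintro _ _ ⟨β, hβ, rfl⟩ ⟨β', hβ', rfl⟩
    exact ⟨β + β', fun i => add_mem (hβ i) (hβ' i), by simp [add_mul, Finset.sum_add_distrib]⟩
  smul_mem' := by
    rintro c _ ⟨β, hβ, rfl⟩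
    exact ⟨c • β, fun i => Submodule.smul_mem _ c (hβ i), by simp [Finset.smul_sum]⟩

theorem mem_certSpan_zero [DecidableEq κ] (f : κ → MvPolynomial σ ℂ) (i : κ) :
    f i ∈ certSpan f 0 := by
  refine ⟨Pi.single i 1, fun j => ?_, ?_⟩
  · rw [mem_restrictTotalDegree]
    by_cases h : j = i
    · subst h; simp
    · simp [Pi.single_eq_of_ne h]
  · rw [Finset.sum_eq_single i] <;> simp +contextual [Pi.single_eq_of_ne]

theorem mul_mem_restrictTotalDegree {p q : MvPolynomial σ ℂ} {d e : ℕ}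
    (hp : p ∈ restrictTotalDegree σ ℂ d) (hq : q ∈ restrictTotalDegree σ ℂ e) :
    p * q ∈ restrictTotalDegree σ ℂ (d + e) := by
  rw [mem_restrictTotalDegree] at *
  exact (totalDegree_mul p q).trans (add_le_add hp hq)

theorem ofNat_mem_restrictTotalDegree (n d : ℕ) [n.AtLeastTwo] :
    (OfNat.ofNat n : MvPolynomial σ ℂ) ∈ restrictTotalDegree σ ℂ d := by
  rw [mem_restrictTotalDegree, ← map_ofNat (C : ℂ →+* MvPolynomial σ ℂ) n, totalDegree_C]
  exact Nat.zero_le d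

theorem mul_mem_certSpan {f : κ → MvPolynomial σ ℂ} {p q : MvPolynomial σ ℂ} {d e : ℕ}
    (hq : q ∈ restrictTotalDegree σ ℂ e) (hp : p ∈ certSpan f d) :
    q * p ∈ certSpan f (e + d) := by
  obtain ⟨β, hβ, rfl⟩ := hp
  exact ⟨fun i => q * β i, fun i => mul_mem_restrictTotalDegree hq (hβ i),
    by simp [Finset.mul_sum, mul_assoc]⟩

theorem certSpan_mono (f : κ → MvPolynomial σ ℂ) {d e : ℕ} (h : d ≤ e) :
    certSpan f d ≤ certSpan f e := by
  rintro _ ⟨β, hβ, rfl⟩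
  refine ⟨β, fun i => ?_, rfl⟩
  have := hβ i
  rw [mem_restrictTotalDegree] at *
  exact this.trans h

theorem mul_mem_certSpan_of_le {f : κ → MvPolynomial σ ℂ} {p q : MvPolynomial σ ℂ} {d e k : ℕ}
    (h : e + d ≤ k) (hq : q ∈ restrictTotalDegree σ ℂ e) (hp : p ∈ certSpan f d) :
    q * p ∈ certSpan f k :=
  certSpan_mono f h (mul_mem_certSpan hq hp)

/-- A certificate of degree at most `d` can be padded with a Koszul syzygy to one of degree
exactly `d`. -/
theorem hasNullstellensatzCertificate_of_one_mem [Nontrivial κ] [Nonempty σ]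
    {f : κ → MvPolynomial σ ℂ} {d : ℕ} (hf : ∀ i, (f i).totalDegree ≤ d)
    (h : (1 : MvPolynomial σ ℂ) ∈ certSpan f d) : HasNullstellensatzCertificate f d := by
  classical
  obtain ⟨β, hβ, hsum⟩ := h
  simp only [mem_restrictTotalDegree] at hβ
  by_cases hd : ∃ i, (β i).totalDegree = d
  · obtain ⟨i, hi⟩ := hd
    exact ⟨β, hsum, le_antisymm (Finset.sup_le fun j _ => hβ j)
      (hi ▸ Finset.le_sup (f := fun i => (β i).totalDegree) (Finset.mem_univ i))⟩
  push Not at hd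
  have hlt : ∀ i, (β i).totalDegree < d := fun i => lt_of_le_of_ne (hβ i) (hd i)
  obtain ⟨i₀, h₀⟩ : ∃ i, f i ≠ 0 := by
    by_contra! h
    simp [h] at hsum
  -- With `f i` of maximal degree, the syzygy `(g * f i) * f j - (g * f j) * f i = 0` can be scaled
  -- so that `g * f i` has degree exactly `d` while `g * f j` stays within `d`.
  obtain ⟨i, hi, hmax⟩ := Finset.exists_max_image (Finset.univ.filter fun i => f i ≠ 0)
    (fun i => (f i).totalDegree) ⟨i₀, by simp [h₀]⟩
  have hfi : f i ≠ 0 := by simpa using hi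
  have hle : ∀ j, (f j).totalDegree ≤ (f i).totalDegree := fun j => by
    by_cases hj : f j = 0
    · simp [hj]
    · exact hmax j (by simp [hj])
  obtain ⟨j, hj⟩ := exists_ne i
  obtain ⟨s⟩ := ‹Nonempty σ›
  set g : MvPolynomial σ ℂ := X s ^ (d - (f i).totalDegree) with hg
  have hgd : g.totalDegree = d - (f i).totalDegree := by simp [hg, totalDegree_X_pow]
  have hg0 : g ≠ 0 := pow_ne_zero _ (X_ne_zero s)
  have hgf : (g * f i).totalDegree = d := by
    rw [totalDegree_mul_of_isDomain hg0 hfi, hgd]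
    have := hf i
    omega
  have hgf' : (g * f j).totalDegree ≤ d := by
    refine (totalDegree_mul _ _).trans ?_
    have := hf i
    have := hle j
    omega
  refine ⟨β + Pi.single j (g * f i) - Pi.single i (g * f j), ?_, le_antisymm ?_ ?_⟩
  · simp only [Pi.sub_apply, Pi.add_apply, sub_mul, add_mul, Finset.sum_sub_distrib,
      Finset.sum_add_distrib, hsum]
    rw [Finset.sum_eq_single j (by simp +contextual [Pi.single_eq_of_ne]) (by simp),
      Finset.sum_eq_single i (by simp +contextual [Pi.single_eq_of_ne]) (by simp)]
    simp only [Pi.single_eq_same]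
    ring
  · refine Finset.sup_le fun k _ => ?_
    have hs : ∀ (a k : κ) (p : MvPolynomial σ ℂ), p.totalDegree ≤ d →
        ((Pi.single a p : κ → MvPolynomial σ ℂ) k).totalDegree ≤ d := by
      intro a k p hp
      by_cases h : k = a
      · subst h; simpa using hp
      · simp [Pi.single_eq_of_ne h]
    exact (totalDegree_sub _ _).trans (max_le ((totalDegree_add _ _).trans
      (max_le (hβ k) (hs j k _ hgf.le))) (hs i k _ hgf'))
  · refine le_trans (le_of_eq ?_) (Finset.le_sup (Finset.mem_univ j))
    simp only [Pi.sub_apply, Pi.add_apply, Pi.single_eq_same, Pi.single_eq_of_ne hj, sub_zero]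
    rw [add_comm, totalDegree_add_eq_left_of_totalDegree_lt (by rw [hgf]; exact hlt j), hgf]

end Certificates

/-! ### The sign gate: symmetries, eliminations, and the certificate of degree 6. -/

section SignGate

variable {κ σ ι : Type*} [Fintype κ]

/-- Linear forms `a₁`, `a₂`, `b₁`, `b₂`, `l`, given by their values at points of `ι`, and scalars
`α₁`, `α₂`, `β₁`, `β₂`, `c` of degree at most one which implement a heralded sign gate
`aᵢ bⱼ ↦ ± xᵢ yⱼ` (with the sign `-` for `i = j = 2` only) modulo the span of `f`. The points `p₁`,
`p₂`, `q₁`, `q₂` are dual to the coordinates `x₁`, `x₂`, `y₁`, `y₂`. -/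
structure SignGate (f : κ → MvPolynomial σ ℂ) (ι : Type*) where
  (a₁ a₂ b₁ b₂ l x₁ x₂ y₁ y₂ : ι → MvPolynomial σ ℂ)
  (α₁ α₂ β₁ β₂ c : MvPolynomial σ ℂ)
  (p₁ p₂ q₁ q₂ : ι)
  deg_a₁ : ∀ i, a₁ i ∈ restrictTotalDegree σ ℂ 1
  deg_a₂ : ∀ i, a₂ i ∈ restrictTotalDegree σ ℂ 1
  deg_b₁ : ∀ i, b₁ i ∈ restrictTotalDegree σ ℂ 1
  deg_b₂ : ∀ i, b₂ i ∈ restrictTotalDegree σ ℂ 1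
  deg_l : ∀ i, l i ∈ restrictTotalDegree σ ℂ 1
  deg_x₁ : ∀ i, x₁ i ∈ restrictTotalDegree σ ℂ 0
  deg_x₂ : ∀ i, x₂ i ∈ restrictTotalDegree σ ℂ 0
  deg_y₁ : ∀ i, y₁ i ∈ restrictTotalDegree σ ℂ 0
  deg_y₂ : ∀ i, y₂ i ∈ restrictTotalDegree σ ℂ 0
  deg_α₁ : α₁ ∈ restrictTotalDegree σ ℂ 1
  deg_α₂ : α₂ ∈ restrictTotalDegree σ ℂ 1
  deg_β₁ : β₁ ∈ restrictTotalDegree σ ℂ 1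
  deg_β₂ : β₂ ∈ restrictTotalDegree σ ℂ 1
  deg_c : c ∈ restrictTotalDegree σ ℂ 1
  x₁_p₁ : x₁ p₁ = 1
  x₁_p₂ : x₁ p₂ = 0
  x₁_q₁ : x₁ q₁ = 0
  x₁_q₂ : x₁ q₂ = 0
  x₂_p₁ : x₂ p₁ = 0
  x₂_p₂ : x₂ p₂ = 1
  x₂_q₁ : x₂ q₁ = 0
  x₂_q₂ : x₂ q₂ = 0
  y₁_p₁ : y₁ p₁ = 0
  y₁_p₂ : y₁ p₂ = 0
  y₁_q₁ : y₁ q₁ = 1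
  y₁_q₂ : y₁ q₂ = 0
  y₂_p₁ : y₂ p₁ = 0
  y₂_p₂ : y₂ p₂ = 0
  y₂_q₁ : y₂ q₁ = 0
  y₂_q₂ : y₂ q₂ = 1
  mem₁₁ : ∀ i j, gateForm α₁ β₁ c a₁ b₁ l i j - sym2 x₁ y₁ i j ∈ certSpan f 0
  mem₁₂ : ∀ i j, gateForm α₁ β₂ c a₁ b₂ l i j - sym2 x₁ y₂ i j ∈ certSpan f 0
  mem₂₁ : ∀ i j, gateForm α₂ β₁ c a₂ b₁ l i j - sym2 x₂ y₁ i j ∈ certSpan f 0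
  mem₂₂ : ∀ i j, gateForm α₂ β₂ c a₂ b₂ l i j + sym2 x₂ y₂ i j ∈ certSpan f 0

namespace SignGate

variable {f : κ → MvPolynomial σ ℂ} (S : SignGate f ι)

/-- The symmetry exchanging the two tensor factors. -/
noncomputable def swapFactors : SignGate f ι where
  a₁ := S.b₁
  a₂ := S.b₂
  b₁ := S.a₁
  b₂ := S.a₂
  l := S.l
  x₁ := S.y₁
  x₂ := S.y₂
  y₁ := S.x₁
  y₂ := S.x₂
  α₁ := S.β₁
  α₂ := S.β₂
  β₁ := S.α₁
  β₂ := S.α₂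
  c := S.c
  p₁ := S.q₁
  p₂ := S.q₂
  q₁ := S.p₁
  q₂ := S.p₂
  deg_a₁ := S.deg_b₁
  deg_a₂ := S.deg_b₂
  deg_b₁ := S.deg_a₁
  deg_b₂ := S.deg_a₂
  deg_l := S.deg_l
  deg_x₁ := S.deg_y₁
  deg_x₂ := S.deg_y₂
  deg_y₁ := S.deg_x₁
  deg_y₂ := S.deg_x₂
  deg_α₁ := S.deg_β₁
  deg_α₂ := S.deg_β₂
  deg_β₁ := S.deg_α₁
  deg_β₂ := S.deg_α₂
  deg_c := S.deg_c
  x₁_p₁ := S.y₁_q₁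
  x₁_p₂ := S.y₁_q₂
  x₁_q₁ := S.y₁_p₁
  x₁_q₂ := S.y₁_p₂
  x₂_p₁ := S.y₂_q₁
  x₂_p₂ := S.y₂_q₂
  x₂_q₁ := S.y₂_p₁
  x₂_q₂ := S.y₂_p₂
  y₁_p₁ := S.x₁_q₁
  y₁_p₂ := S.x₁_q₂
  y₁_q₁ := S.x₁_p₁
  y₁_q₂ := S.x₁_p₂
  y₂_p₁ := S.x₂_q₁
  y₂_p₂ := S.x₂_q₂
  y₂_q₁ := S.x₂_p₁
  y₂_q₂ := S.x₂_p₂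
  mem₁₁ i j := by convert S.mem₁₁ i j using 1; simp only [gateForm, sym2]; ring
  mem₁₂ i j := by convert S.mem₂₁ i j using 1; simp only [gateForm, sym2]; ring
  mem₂₁ i j := by convert S.mem₁₂ i j using 1; simp only [gateForm, sym2]; ring
  mem₂₂ i j := by convert S.mem₂₂ i j using 1; simp only [gateForm, sym2]; ring

/-- The symmetry exchanging the two basis vectors of the second tensor factor. -/
noncomputable def swapSecond : SignGate f ι where
  a₁ := S.a₁
  a₂ i := -S.a₂ i
  b₁ := S.b₂
  b₂ := S.b₁
  l := S.l
  x₁ := S.x₁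
  x₂ := S.x₂
  y₁ := S.y₂
  y₂ := S.y₁
  α₁ := S.α₁
  α₂ := -S.α₂
  β₁ := S.β₂
  β₂ := S.β₁
  c := S.c
  p₁ := S.p₁
  p₂ := S.p₂
  q₁ := S.q₂
  q₂ := S.q₁
  deg_a₁ := S.deg_a₁
  deg_a₂ i := neg_mem (S.deg_a₂ i)
  deg_b₁ := S.deg_b₂
  deg_b₂ := S.deg_b₁
  deg_l := S.deg_l
  deg_x₁ := S.deg_x₁
  deg_x₂ := S.deg_x₂
  deg_y₁ := S.deg_y₂
  deg_y₂ := S.deg_y₁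
  deg_α₁ := S.deg_α₁
  deg_α₂ := neg_mem S.deg_α₂
  deg_β₁ := S.deg_β₂
  deg_β₂ := S.deg_β₁
  deg_c := S.deg_c
  x₁_p₁ := S.x₁_p₁
  x₁_p₂ := S.x₁_p₂
  x₁_q₁ := S.x₁_q₂
  x₁_q₂ := S.x₁_q₁
  x₂_p₁ := S.x₂_p₁
  x₂_p₂ := S.x₂_p₂
  x₂_q₁ := S.x₂_q₂
  x₂_q₂ := S.x₂_q₁
  y₁_p₁ := S.y₂_p₁
  y₁_p₂ := S.y₂_p₂
  y₁_q₁ := S.y₂_q₂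
  y₁_q₂ := S.y₂_q₁
  y₂_p₁ := S.y₁_p₁
  y₂_p₂ := S.y₁_p₂
  y₂_q₁ := S.y₁_q₂
  y₂_q₂ := S.y₁_q₁
  mem₁₁ := S.mem₁₂
  mem₁₂ := S.mem₁₁
  mem₂₁ i j := by
    convert neg_mem (S.mem₂₂ i j) using 1; simp only [gateForm, sym2]; ring
  mem₂₂ i j := by
    convert neg_mem (S.mem₂₁ i j) using 1; simp only [gateForm, sym2]; ring

/-- The combination of `a₁` and `a₂` in which `α` cancels. -/
noncomputable def m (i : ι) : MvPolynomial σ ℂ := S.α₂ * S.a₁ i - S.α₁ * S.a₂ i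
/-- The combination of `b₁` and `b₂` in which `β` cancels. -/
noncomputable def n (i : ι) : MvPolynomial σ ℂ := S.β₂ * S.b₁ i - S.β₁ * S.b₂ i
/-- The linear form `c * a₁ + α₁ * l`. -/
noncomputable def u₁ (i : ι) : MvPolynomial σ ℂ := S.c * S.a₁ i + S.α₁ * S.l i
/-- The linear form `c * a₂ + α₂ * l`. -/
noncomputable def u₂ (i : ι) : MvPolynomial σ ℂ := S.c * S.a₂ i + S.α₂ * S.l i
/-- The linear form `c * b₁ + β₁ * l`. -/
noncomputable def v₁ (i : ι) : MvPolynomial σ ℂ := S.c * S.b₁ i + S.β₁ * S.l i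
/-- The linear form `c * b₂ + β₂ * l`. -/
noncomputable def v₂ (i : ι) : MvPolynomial σ ℂ := S.c * S.b₂ i + S.β₂ * S.l i

/-- The polarization of the relation for `a₁ b₁ ↦ x₁ y₁`. -/
noncomputable def gate₁₁ (i j : ι) : MvPolynomial σ ℂ :=
  gateForm S.α₁ S.β₁ S.c S.a₁ S.b₁ S.l i j - sym2 S.x₁ S.y₁ i j
/-- The polarization of the relation for `a₁ b₂ ↦ x₁ y₂`. -/
noncomputable def gate₁₂ (i j : ι) : MvPolynomial σ ℂ :=
  gateForm S.α₁ S.β₂ S.c S.a₁ S.b₂ S.l i j - sym2 S.x₁ S.y₂ i j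
/-- The polarization of the relation for `a₂ b₁ ↦ x₂ y₁`. -/
noncomputable def gate₂₁ (i j : ι) : MvPolynomial σ ℂ :=
  gateForm S.α₂ S.β₁ S.c S.a₂ S.b₁ S.l i j - sym2 S.x₂ S.y₁ i j
/-- The polarization of the relation for `a₂ b₂ ↦ -x₂ y₂`. -/
noncomputable def gate₂₂ (i j : ι) : MvPolynomial σ ℂ :=
  gateForm S.α₂ S.β₂ S.c S.a₂ S.b₂ S.l i j + sym2 S.x₂ S.y₂ i j

/-- The polarization of `l b₁ m + y₁ (x₁ a₂ - x₂ a₁)`. -/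
noncomputable def cubic₁ (i j k : ι) : MvPolynomial σ ℂ :=
  sym3 S.l S.b₁ S.m i j k + sym3 S.y₁ S.x₁ S.a₂ i j k - sym3 S.y₁ S.x₂ S.a₁ i j k
/-- The polarization of `l b₂ m + y₂ (x₁ a₂ + x₂ a₁)`. -/
noncomputable def cubic₂ (i j k : ι) : MvPolynomial σ ℂ :=
  sym3 S.l S.b₂ S.m i j k + sym3 S.y₂ S.x₁ S.a₂ i j k + sym3 S.y₂ S.x₂ S.a₁ i j k
/-- The polarization of `y₁ (x₁ u₂ - x₂ u₁) - β₁ l² m`. -/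
noncomputable def scaledCubic₁ (i j k : ι) : MvPolynomial σ ℂ :=
  sym3 S.y₁ S.x₁ S.u₂ i j k - sym3 S.y₁ S.x₂ S.u₁ i j k - S.β₁ * sym3 S.l S.l S.m i j k
/-- The polarization of `y₂ (x₁ u₂ + x₂ u₁) - β₂ l² m`. -/
noncomputable def scaledCubic₂ (i j k : ι) : MvPolynomial σ ℂ :=
  sym3 S.y₂ S.x₁ S.u₂ i j k + sym3 S.y₂ S.x₂ S.u₁ i j k - S.β₂ * sym3 S.l S.l S.m i j k
/-- The polarization of `m v₁ - y₁ (α₂ x₁ - α₁ x₂)`. -/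
noncomputable def quadric₁ (i j : ι) : MvPolynomial σ ℂ :=
  sym2 S.m S.v₁ i j - S.α₂ * sym2 S.y₁ S.x₁ i j + S.α₁ * sym2 S.y₁ S.x₂ i j
/-- The polarization of `m v₂ - y₂ (α₂ x₁ + α₁ x₂)`. -/
noncomputable def quadric₂ (i j : ι) : MvPolynomial σ ℂ :=
  sym2 S.m S.v₂ i j - S.α₂ * sym2 S.y₂ S.x₁ i j - S.α₁ * sym2 S.y₂ S.x₂ i j
/-- The polarization of the determinant relation `l² m n = 2 x₁ x₂ y₁ y₂`. -/
noncomputable def quartic (i j k r : ι) : MvPolynomial σ ℂ :=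
  sym4 S.l S.l S.m S.n i j k r - 2 * sym4 S.x₁ S.x₂ S.y₁ S.y₂ i j k r
/-- The polarization of `x₁ (y₁ b₂ - y₂ b₁) + l a₁ n`. -/
noncomputable def conj₁ (i j k : ι) : MvPolynomial σ ℂ :=
  sym3 S.x₁ S.y₁ S.b₂ i j k - sym3 S.x₁ S.y₂ S.b₁ i j k + sym3 S.l S.a₁ S.n i j k
/-- The polarization of `x₂ (y₁ b₂ + y₂ b₁) + l a₂ n`. -/
noncomputable def conj₂ (i j k : ι) : MvPolynomial σ ℂ :=
  sym3 S.x₂ S.y₁ S.b₂ i j k + sym3 S.x₂ S.y₂ S.b₁ i j k + sym3 S.l S.a₂ S.n i j k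
/-- The polarization of `y₁ b₂ (x₂ a₁ - x₁ a₂) + y₂ b₁ (x₂ a₁ + x₁ a₂)`. -/
noncomputable def star (i j k r : ι) : MvPolynomial σ ℂ :=
  sym4 S.y₁ S.b₂ S.x₂ S.a₁ i j k r - sym4 S.y₁ S.b₂ S.x₁ S.a₂ i j k r +
    sym4 S.y₂ S.b₁ S.x₂ S.a₁ i j k r + sym4 S.y₂ S.b₁ S.x₁ S.a₂ i j k r

/-- Unpolarized, this is `a₁ * gate₂₁ - a₂ * gate₁₁`: the terms containing `a₁ a₂` cancel and those
with `α` combine to `l b₁ m`. The next three lemmas are the same elimination for the other pairs of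
gates. -/
theorem cubic₁_eq (i j k : ι) : S.cubic₁ i j k =
    S.a₁ i * S.gate₂₁ j k + S.a₁ j * S.gate₂₁ i k + S.a₁ k * S.gate₂₁ i j -
    (S.a₂ i * S.gate₁₁ j k + S.a₂ j * S.gate₁₁ i k + S.a₂ k * S.gate₁₁ i j) := by
  simp only [cubic₁, gate₁₁, gate₂₁, gateForm, sym3, sym2, m]
  ring

theorem cubic₂_eq (i j k : ι) : S.cubic₂ i j k =
    S.a₁ i * S.gate₂₂ j k + S.a₁ j * S.gate₂₂ i k + S.a₁ k * S.gate₂₂ i j -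
    (S.a₂ i * S.gate₁₂ j k + S.a₂ j * S.gate₁₂ i k + S.a₂ k * S.gate₁₂ i j) := by
  simp only [cubic₂, gate₁₂, gate₂₂, gateForm, sym3, sym2, m]
  ring

theorem conj₁_eq (i j k : ι) : S.conj₁ i j k =
    S.b₁ i * S.gate₁₂ j k + S.b₁ j * S.gate₁₂ i k + S.b₁ k * S.gate₁₂ i j -
    (S.b₂ i * S.gate₁₁ j k + S.b₂ j * S.gate₁₁ i k + S.b₂ k * S.gate₁₁ i j) := by
  simp only [conj₁, gate₁₂, gate₁₁, gateForm, sym3, sym2, n]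
  ring

theorem conj₂_eq (i j k : ι) : S.conj₂ i j k =
    S.b₁ i * S.gate₂₂ j k + S.b₁ j * S.gate₂₂ i k + S.b₁ k * S.gate₂₂ i j -
    (S.b₂ i * S.gate₂₁ j k + S.b₂ j * S.gate₂₁ i k + S.b₂ k * S.gate₂₁ i j) := by
  simp only [conj₂, gate₂₂, gate₂₁, gateForm, sym3, sym2, n]
  ring

/-- Weighting by `α₂` and `α₁` cancels the terms `α₁ α₂ l b₁`. -/
theorem quadric₁_eq (i j : ι) :
    S.quadric₁ i j = S.α₂ * S.gate₁₁ i j - S.α₁ * S.gate₂₁ i j := by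
  simp only [quadric₁, gate₁₁, gate₂₁, gateForm, sym2, m, v₁]
  ring

theorem quadric₂_eq (i j : ι) :
    S.quadric₂ i j = S.α₂ * S.gate₁₂ i j - S.α₁ * S.gate₂₂ i j := by
  simp only [quadric₂, gate₁₂, gate₂₂, gateForm, sym2, m, v₂]
  ring

/-- Since `v₁ = c b₁ + β₁ l`, subtracting `l` times the quadric trades `c l b₁ m` for `-β₁ l² m` and
completes `c aᵢ` to `uᵢ`. -/
theorem scaledCubic₁_eq (i j k : ι) : S.scaledCubic₁ i j k = S.c * S.cubic₁ i j k -
    (S.l i * S.quadric₁ j k + S.l j * S.quadric₁ i k + S.l k * S.quadric₁ i j) := by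
  simp only [scaledCubic₁, cubic₁, quadric₁, sym3, sym2, u₁, u₂, v₁]
  ring

theorem scaledCubic₂_eq (i j k : ι) : S.scaledCubic₂ i j k = S.c * S.cubic₂ i j k -
    (S.l i * S.quadric₂ j k + S.l j * S.quadric₂ i k + S.l k * S.quadric₂ i j) := by
  simp only [scaledCubic₂, cubic₂, quadric₂, sym3, sym2, u₁, u₂, v₂]
  ring

theorem gate₁₁_mem (i j : ι) : S.gate₁₁ i j ∈ certSpan f 0 := S.mem₁₁ i j
theorem gate₁₂_mem (i j : ι) : S.gate₁₂ i j ∈ certSpan f 0 := S.mem₁₂ i j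
theorem gate₂₁_mem (i j : ι) : S.gate₂₁ i j ∈ certSpan f 0 := S.mem₂₁ i j
theorem gate₂₂_mem (i j : ι) : S.gate₂₂ i j ∈ certSpan f 0 := S.mem₂₂ i j

theorem symm_mem {g : ι → MvPolynomial σ ℂ} {T : ι → ι → MvPolynomial σ ℂ} {d e : ℕ}
    (hg : ∀ i, g i ∈ restrictTotalDegree σ ℂ e) (hT : ∀ i j, T i j ∈ certSpan f d) (i j k : ι) :
    g i * T j k + g j * T i k + g k * T i j ∈ certSpan f (e + d) :=
  add_mem (add_mem (mul_mem_certSpan (hg i) (hT j k)) (mul_mem_certSpan (hg j) (hT i k)))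
    (mul_mem_certSpan (hg k) (hT i j))

theorem cubic₁_mem (i j k : ι) : S.cubic₁ i j k ∈ certSpan f 1 := by
  rw [cubic₁_eq]
  have h₁ := symm_mem S.deg_a₁ S.gate₂₁_mem i j k
  have h₂ := symm_mem S.deg_a₂ S.gate₁₁_mem i j k
  exact sub_mem h₁ h₂

theorem cubic₂_mem (i j k : ι) : S.cubic₂ i j k ∈ certSpan f 1 := by
  rw [cubic₂_eq]
  have h₁ := symm_mem S.deg_a₁ S.gate₂₂_mem i j k
  have h₂ := symm_mem S.deg_a₂ S.gate₁₂_mem i j k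
  exact sub_mem h₁ h₂

theorem conj₁_mem (i j k : ι) : S.conj₁ i j k ∈ certSpan f 1 := by
  rw [conj₁_eq]
  have h₁ := symm_mem S.deg_b₁ S.gate₁₂_mem i j k
  have h₂ := symm_mem S.deg_b₂ S.gate₁₁_mem i j k
  exact sub_mem h₁ h₂

theorem conj₂_mem (i j k : ι) : S.conj₂ i j k ∈ certSpan f 1 := by
  rw [conj₂_eq]
  have h₁ := symm_mem S.deg_b₁ S.gate₂₂_mem i j k
  have h₂ := symm_mem S.deg_b₂ S.gate₂₁_mem i j k
  exact sub_mem h₁ h₂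

theorem quadric₁_mem (i j : ι) : S.quadric₁ i j ∈ certSpan f 1 := by
  rw [quadric₁_eq]
  have h₁ := mul_mem_certSpan S.deg_α₂ (S.gate₁₁_mem i j)
  have h₂ := mul_mem_certSpan S.deg_α₁ (S.gate₂₁_mem i j)
  exact sub_mem h₁ h₂

theorem quadric₂_mem (i j : ι) : S.quadric₂ i j ∈ certSpan f 1 := by
  rw [quadric₂_eq]
  have h₁ := mul_mem_certSpan S.deg_α₂ (S.gate₁₂_mem i j)
  have h₂ := mul_mem_certSpan S.deg_α₁ (S.gate₂₂_mem i j)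
  exact sub_mem h₁ h₂

theorem scaledCubic₁_mem (i j k : ι) : S.scaledCubic₁ i j k ∈ certSpan f 2 := by
  rw [scaledCubic₁_eq]
  have h₁ := mul_mem_certSpan S.deg_c (S.cubic₁_mem i j k)
  have h₂ := symm_mem S.deg_l S.quadric₁_mem i j k
  exact sub_mem h₁ h₂

theorem scaledCubic₂_mem (i j k : ι) : S.scaledCubic₂ i j k ∈ certSpan f 2 := by
  rw [scaledCubic₂_eq]
  have h₁ := mul_mem_certSpan S.deg_c (S.cubic₂_mem i j k)
  have h₂ := symm_mem S.deg_l S.quadric₂_mem i j k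
  exact sub_mem h₁ h₂

/-- In `a₁ * conj₂ - a₂ * conj₁` the common term `l a₁ a₂ n` cancels, leaving a relation free of
`l`. -/
theorem star_eq (i j k r : ι) : S.star i j k r =
    S.a₁ i * S.conj₂ j k r + S.a₁ j * S.conj₂ i k r + S.a₁ k * S.conj₂ i j r +
      S.a₁ r * S.conj₂ i j k -
    (S.a₂ i * S.conj₁ j k r + S.a₂ j * S.conj₁ i k r + S.a₂ k * S.conj₁ i j r +
      S.a₂ r * S.conj₁ i j k) := by
  simp only [star, conj₁, conj₂, sym4, sym3, sym2]
  ring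

theorem star_mem (i j k r : ι) : S.star i j k r ∈ certSpan f 2 := by
  have h₁ (i j k r : ι) := mul_mem_certSpan (S.deg_a₁ i) (S.conj₂_mem j k r)
  have h₂ (i j k r : ι) := mul_mem_certSpan (S.deg_a₂ i) (S.conj₁_mem j k r)
  rw [star_eq]
  exact sub_mem (add_mem (add_mem (add_mem (h₁ i j k r) (h₁ j i k r)) (h₁ k i j r)) (h₁ r i j k))
    (add_mem (add_mem (add_mem (h₂ i j k r) (h₂ j i k r)) (h₂ k i j r)) (h₂ r i j k))

/-- The summand of the determinant relation in which the first factor carries the arguments `i`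
and `j`, and the second one `k` and `r`. -/
noncomputable def detTerm (i j k r : ι) : MvPolynomial σ ℂ :=
  gateForm S.α₂ S.β₁ S.c S.a₂ S.b₁ S.l k r * S.gate₁₂ i j + sym2 S.x₁ S.y₂ i j * S.gate₂₁ k r -
    gateForm S.α₂ S.β₂ S.c S.a₂ S.b₂ S.l k r * S.gate₁₁ i j - sym2 S.x₁ S.y₁ i j * S.gate₂₂ k r

/-- A product of two gate forms minus the product of their targets telescopes into multiples of the
gate relations; one multiplier is a gate form of degree 3, the other is constant. -/
theorem detTerm_eq (i j k r : ι) : S.detTerm i j k r =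
    gateForm S.α₁ S.β₂ S.c S.a₁ S.b₂ S.l i j * gateForm S.α₂ S.β₁ S.c S.a₂ S.b₁ S.l k r -
    gateForm S.α₁ S.β₁ S.c S.a₁ S.b₁ S.l i j * gateForm S.α₂ S.β₂ S.c S.a₂ S.b₂ S.l k r -
    (sym2 S.x₁ S.y₂ i j * sym2 S.x₂ S.y₁ k r + sym2 S.x₁ S.y₁ i j * sym2 S.x₂ S.y₂ k r) := by
  simp only [detTerm, gate₁₁, gate₁₂, gate₂₁, gate₂₂]
  ring

/-- The six summands are the ways to give two of the four arguments to the first factor, so their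
sum polarizes the determinant. -/
theorem quartic_eq (i j k r : ι) : S.quartic i j k r =
    S.detTerm i j k r + S.detTerm i k j r + S.detTerm i r j k + S.detTerm j k i r +
      S.detTerm j r i k + S.detTerm k r i j := by
  simp only [detTerm_eq, quartic, gateForm, sym4, sym3, sym2, m, n]
  ring

theorem sym2_mem {g h : ι → MvPolynomial σ ℂ} {d e : ℕ}
    (hg : ∀ i, g i ∈ restrictTotalDegree σ ℂ d) (hh : ∀ i, h i ∈ restrictTotalDegree σ ℂ e)
    (i j : ι) : sym2 g h i j ∈ restrictTotalDegree σ ℂ (d + e) :=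
  add_mem (mul_mem_restrictTotalDegree (hg i) (hh j)) (mul_mem_restrictTotalDegree (hg j) (hh i))

theorem gateForm_mem {g h l : ι → MvPolynomial σ ℂ} {α β c : MvPolynomial σ ℂ}
    (hg : ∀ i, g i ∈ restrictTotalDegree σ ℂ 1) (hh : ∀ i, h i ∈ restrictTotalDegree σ ℂ 1)
    (hl : ∀ i, l i ∈ restrictTotalDegree σ ℂ 1) (hα : α ∈ restrictTotalDegree σ ℂ 1)
    (hβ : β ∈ restrictTotalDegree σ ℂ 1) (hc : c ∈ restrictTotalDegree σ ℂ 1)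
    (i j : ι) : gateForm α β c g h l i j ∈ restrictTotalDegree σ ℂ 3 := by
  have h₁ := mul_mem_restrictTotalDegree hα (sym2_mem hl hh i j)
  have h₂ := mul_mem_restrictTotalDegree hβ (sym2_mem hl hg i j)
  have h₃ := mul_mem_restrictTotalDegree hc (sym2_mem hg hh i j)
  exact add_mem (add_mem h₁ h₂) h₃

theorem detTerm_mem (i j k r : ι) : S.detTerm i j k r ∈ certSpan f 3 := by
  have h₁ := mul_mem_certSpan (gateForm_mem S.deg_a₂ S.deg_b₁ S.deg_l S.deg_α₂ S.deg_β₁ S.deg_c k r)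
    (S.gate₁₂_mem i j)
  have h₂ := mul_mem_certSpan_of_le (Nat.zero_le 3) (sym2_mem S.deg_x₁ S.deg_y₂ i j)
    (S.gate₂₁_mem k r)
  have h₃ := mul_mem_certSpan (gateForm_mem S.deg_a₂ S.deg_b₂ S.deg_l S.deg_α₂ S.deg_β₂ S.deg_c k r)
    (S.gate₁₁_mem i j)
  have h₄ := mul_mem_certSpan_of_le (Nat.zero_le 3) (sym2_mem S.deg_x₁ S.deg_y₁ i j)
    (S.gate₂₂_mem k r)
  exact sub_mem (sub_mem (add_mem h₁ h₂) h₃) h₄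

theorem quartic_mem (i j k r : ι) : S.quartic i j k r ∈ certSpan f 3 := by
  rw [quartic_eq]
  exact add_mem (add_mem (add_mem (add_mem (add_mem (S.detTerm_mem _ _ _ _)
    (S.detTerm_mem _ _ _ _)) (S.detTerm_mem _ _ _ _)) (S.detTerm_mem _ _ _ _))
    (S.detTerm_mem _ _ _ _)) (S.detTerm_mem _ _ _ _)

/-- An explicit syzygy, verified by expansion at the dual points. Only the `x`, `y` parts of three
terms contribute linearly: `20 * l p₁` from the last quartic and `-6 * l p₁` from each of `gate₁₁ p₁
q₁` and `gate₁₂ p₁ q₂`; all terms of higher degree cancel. Each multiplier, together with the degree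
of its relation, stays within 4. -/
theorem eight_mul_l_p₁ : 8 * S.l S.p₁ =
    (6 * S.l S.p₁) * S.gate₁₁ S.p₁ S.q₁ -
    (3 * S.l S.q₁) * S.gate₁₁ S.p₁ S.p₁ -
    (3 * S.l S.q₂) * S.gate₁₂ S.p₁ S.p₁ +
    (6 * S.l S.p₁) * S.gate₁₂ S.p₁ S.q₂ -
    (18 * (S.β₂ * S.l S.q₁ * S.l S.q₂)) * S.cubic₁ S.p₁ S.p₁ S.p₂ -
    (6 * (S.β₁ * S.l S.p₂ * S.l S.q₁) + 6 * (S.β₂ * S.l S.p₂ * S.l S.q₂)) * S.cubic₁ S.p₁ S.p₁ S.q₁ +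
    (3 * (S.β₁ * S.l S.p₁ * S.l S.p₂)) * S.cubic₁ S.p₁ S.q₁ S.q₁ +
    (6 * (S.β₂ * S.l S.p₁ * S.l S.p₂)) * S.cubic₁ S.p₁ S.q₁ S.q₂ +
    (6 * (S.β₂ * S.l S.p₁ * S.l S.p₁)) * S.cubic₁ S.p₂ S.q₁ S.q₂ +
    (18 * (S.β₁ * S.l S.q₁ * S.l S.q₂)) * S.cubic₂ S.p₁ S.p₁ S.p₂ +
    (6 * (S.β₂ * S.l S.p₂ * S.l S.q₂) + 6 * (S.β₁ * S.l S.p₂ * S.l S.q₁)) * S.cubic₂ S.p₁ S.p₁ S.q₂ -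
    (6 * (S.β₁ * S.l S.p₁ * S.l S.p₂)) * S.cubic₂ S.p₁ S.q₁ S.q₂ -
    (3 * (S.β₂ * S.l S.p₁ * S.l S.p₂)) * S.cubic₂ S.p₁ S.q₂ S.q₂ -
    (6 * (S.β₁ * S.l S.p₁ * S.l S.p₁)) * S.cubic₂ S.p₂ S.q₁ S.q₂ -
    (3 * (S.b₁ S.q₁ * S.l S.q₁) + 5 * (S.b₂ S.q₁ * S.l S.q₂) + 3 * (S.b₂ S.q₂ * S.l S.q₁)) * S.scaledCubic₁ S.p₁ S.p₁ S.p₂ -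
    (2 * (S.b₂ S.q₁ * S.l S.p₂)) * S.scaledCubic₁ S.p₁ S.p₁ S.q₂ -
    (3 * (S.b₂ S.p₁ * S.l S.q₂) - 3 * (S.b₂ S.q₂ * S.l S.p₁) - 3 * (S.b₁ S.q₁ * S.l S.p₁) + 3 * (S.b₁ S.p₁ * S.l S.q₁)) * S.scaledCubic₁ S.p₁ S.p₂ S.q₁ +
    (5 * (S.b₂ S.q₁ * S.l S.p₁) + 3 * (S.b₂ S.p₁ * S.l S.q₁)) * S.scaledCubic₁ S.p₁ S.p₂ S.q₂ -
    (3 * (S.b₁ S.p₁ * S.l S.p₂)) * S.scaledCubic₁ S.p₁ S.q₁ S.q₁ -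
    (6 * (S.b₂ S.p₁ * S.l S.p₂)) * S.scaledCubic₁ S.p₁ S.q₁ S.q₂ +
    (3 * (S.b₁ S.p₁ * S.l S.p₁)) * S.scaledCubic₁ S.p₂ S.q₁ S.q₁ +
    (3 * (S.b₁ S.q₁ * S.l S.q₂) + 3 * (S.b₂ S.q₂ * S.l S.q₂) + 5 * (S.b₁ S.q₂ * S.l S.q₁)) * S.scaledCubic₂ S.p₁ S.p₁ S.p₂ +
    (2 * (S.b₁ S.q₂ * S.l S.p₂)) * S.scaledCubic₂ S.p₁ S.p₁ S.q₁ -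
    (3 * (S.b₁ S.p₁ * S.l S.q₂) + 5 * (S.b₁ S.q₂ * S.l S.p₁)) * S.scaledCubic₂ S.p₁ S.p₂ S.q₁ -
    (3 * (S.b₁ S.q₁ * S.l S.p₁) - 3 * (S.b₁ S.p₁ * S.l S.q₁) - 3 * (S.b₂ S.p₁ * S.l S.q₂) + 3 * (S.b₂ S.q₂ * S.l S.p₁)) * S.scaledCubic₂ S.p₁ S.p₂ S.q₂ +
    (6 * (S.b₁ S.p₁ * S.l S.p₂)) * S.scaledCubic₂ S.p₁ S.q₁ S.q₂ +
    (3 * (S.b₂ S.p₁ * S.l S.p₂)) * S.scaledCubic₂ S.p₁ S.q₂ S.q₂ -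
    (3 * (S.b₂ S.p₁ * S.l S.p₁)) * S.scaledCubic₂ S.p₂ S.q₂ S.q₂ +
    (7 * S.l S.q₂) * S.quartic S.p₁ S.p₁ S.p₂ S.q₁ +
    (7 * S.l S.q₁) * S.quartic S.p₁ S.p₁ S.p₂ S.q₂ +
    (S.l S.p₂) * S.quartic S.p₁ S.p₁ S.q₁ S.q₂ -
    (10 * S.l S.p₁) * S.quartic S.p₁ S.p₂ S.q₁ S.q₂ := by
  simp only [gate₁₁, gate₁₂, cubic₁, cubic₂, scaledCubic₁, scaledCubic₂, quartic, gateForm, sym4,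
    sym3, sym2, m, n, u₁, u₂, S.x₁_p₁, S.x₁_p₂, S.x₁_q₁, S.x₁_q₂, S.x₂_p₁, S.x₂_p₂, S.x₂_q₁,
    S.x₂_q₂, S.y₁_p₁, S.y₁_p₂, S.y₁_q₁, S.y₁_q₂, S.y₂_p₁, S.y₂_p₂, S.y₂_q₁, S.y₂_q₂]
  ring

theorem l_p₁_mem : S.l S.p₁ ∈ certSpan f 4 := by
  have num {d : ℕ} (n : ℕ) [n.AtLeastTwo] {p : MvPolynomial σ ℂ}
      (hp : p ∈ restrictTotalDegree σ ℂ d) : OfNat.ofNat n * p ∈ restrictTotalDegree σ ℂ d := by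
    simpa using mul_mem_restrictTotalDegree (ofNat_mem_restrictTotalDegree n 0) hp
  have mul₂ {p q : MvPolynomial σ ℂ} (hp : p ∈ restrictTotalDegree σ ℂ 1)
      (hq : q ∈ restrictTotalDegree σ ℂ 1) : p * q ∈ restrictTotalDegree σ ℂ 2 :=
    mul_mem_restrictTotalDegree hp hq
  have mul₃ {p q r : MvPolynomial σ ℂ} (hp : p ∈ restrictTotalDegree σ ℂ 1)
      (hq : q ∈ restrictTotalDegree σ ℂ 1) (hr : r ∈ restrictTotalDegree σ ℂ 1) :
      p * q * r ∈ restrictTotalDegree σ ℂ 3 :=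
    mul_mem_restrictTotalDegree (mul₂ hp hq) hr
  have gate {p q : MvPolynomial σ ℂ} (hq : q ∈ certSpan f 0)
      (hp : p ∈ restrictTotalDegree σ ℂ 1) : p * q ∈ certSpan f 4 :=
    mul_mem_certSpan_of_le (by norm_num) hp hq
  have cubic {p q : MvPolynomial σ ℂ} (hq : q ∈ certSpan f 1)
      (hp : p ∈ restrictTotalDegree σ ℂ 3) : p * q ∈ certSpan f 4 :=
    mul_mem_certSpan_of_le le_rfl hp hq
  have scaled {p q : MvPolynomial σ ℂ} (hq : q ∈ certSpan f 2)
      (hp : p ∈ restrictTotalDegree σ ℂ 2) : p * q ∈ certSpan f 4 :=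
    mul_mem_certSpan_of_le le_rfl hp hq
  have quartic {p q : MvPolynomial σ ℂ} (hq : q ∈ certSpan f 3)
      (hp : p ∈ restrictTotalDegree σ ℂ 1) : p * q ∈ certSpan f 4 :=
    mul_mem_certSpan_of_le le_rfl hp hq
  have h : 8 * S.l S.p₁ ∈ certSpan f 4 := by
    rw [eight_mul_l_p₁]
    have h0 := gate (S.gate₁₁_mem S.p₁ S.q₁) (num 6 (S.deg_l S.p₁))
    have h1 := gate (S.gate₁₁_mem S.p₁ S.p₁) (num 3 (S.deg_l S.q₁))
    have h2 := gate (S.gate₁₂_mem S.p₁ S.p₁) (num 3 (S.deg_l S.q₂))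
    have h3 := gate (S.gate₁₂_mem S.p₁ S.q₂) (num 6 (S.deg_l S.p₁))
    have h4 := cubic (S.cubic₁_mem S.p₁ S.p₁ S.p₂) (num 18 (mul₃ S.deg_β₂ (S.deg_l S.q₁) (S.deg_l S.q₂)))
    have h5 := cubic (S.cubic₁_mem S.p₁ S.p₁ S.q₁) (add_mem (num 6 (mul₃ S.deg_β₁ (S.deg_l S.p₂) (S.deg_l S.q₁))) (num 6 (mul₃ S.deg_β₂ (S.deg_l S.p₂) (S.deg_l S.q₂))))
    have h6 := cubic (S.cubic₁_mem S.p₁ S.q₁ S.q₁) (num 3 (mul₃ S.deg_β₁ (S.deg_l S.p₁) (S.deg_l S.p₂)))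
    have h7 := cubic (S.cubic₁_mem S.p₁ S.q₁ S.q₂) (num 6 (mul₃ S.deg_β₂ (S.deg_l S.p₁) (S.deg_l S.p₂)))
    have h8 := cubic (S.cubic₁_mem S.p₂ S.q₁ S.q₂) (num 6 (mul₃ S.deg_β₂ (S.deg_l S.p₁) (S.deg_l S.p₁)))
    have h9 := cubic (S.cubic₂_mem S.p₁ S.p₁ S.p₂) (num 18 (mul₃ S.deg_β₁ (S.deg_l S.q₁) (S.deg_l S.q₂)))
    have h10 := cubic (S.cubic₂_mem S.p₁ S.p₁ S.q₂) (add_mem (num 6 (mul₃ S.deg_β₂ (S.deg_l S.p₂) (S.deg_l S.q₂))) (num 6 (mul₃ S.deg_β₁ (S.deg_l S.p₂) (S.deg_l S.q₁))))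
    have h11 := cubic (S.cubic₂_mem S.p₁ S.q₁ S.q₂) (num 6 (mul₃ S.deg_β₁ (S.deg_l S.p₁) (S.deg_l S.p₂)))
    have h12 := cubic (S.cubic₂_mem S.p₁ S.q₂ S.q₂) (num 3 (mul₃ S.deg_β₂ (S.deg_l S.p₁) (S.deg_l S.p₂)))
    have h13 := cubic (S.cubic₂_mem S.p₂ S.q₁ S.q₂) (num 6 (mul₃ S.deg_β₁ (S.deg_l S.p₁) (S.deg_l S.p₁)))
    have h14 := scaled (S.scaledCubic₁_mem S.p₁ S.p₁ S.p₂) (add_mem (add_mem (num 3 (mul₂ (S.deg_b₁ S.q₁) (S.deg_l S.q₁))) (num 5 (mul₂ (S.deg_b₂ S.q₁) (S.deg_l S.q₂)))) (num 3 (mul₂ (S.deg_b₂ S.q₂) (S.deg_l S.q₁))))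
    have h15 := scaled (S.scaledCubic₁_mem S.p₁ S.p₁ S.q₂) (num 2 (mul₂ (S.deg_b₂ S.q₁) (S.deg_l S.p₂)))
    have h16 := scaled (S.scaledCubic₁_mem S.p₁ S.p₂ S.q₁) (add_mem (sub_mem (sub_mem (num 3 (mul₂ (S.deg_b₂ S.p₁) (S.deg_l S.q₂))) (num 3 (mul₂ (S.deg_b₂ S.q₂) (S.deg_l S.p₁)))) (num 3 (mul₂ (S.deg_b₁ S.q₁) (S.deg_l S.p₁)))) (num 3 (mul₂ (S.deg_b₁ S.p₁) (S.deg_l S.q₁))))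
    have h17 := scaled (S.scaledCubic₁_mem S.p₁ S.p₂ S.q₂) (add_mem (num 5 (mul₂ (S.deg_b₂ S.q₁) (S.deg_l S.p₁))) (num 3 (mul₂ (S.deg_b₂ S.p₁) (S.deg_l S.q₁))))
    have h18 := scaled (S.scaledCubic₁_mem S.p₁ S.q₁ S.q₁) (num 3 (mul₂ (S.deg_b₁ S.p₁) (S.deg_l S.p₂)))
    have h19 := scaled (S.scaledCubic₁_mem S.p₁ S.q₁ S.q₂) (num 6 (mul₂ (S.deg_b₂ S.p₁) (S.deg_l S.p₂)))
    have h20 := scaled (S.scaledCubic₁_mem S.p₂ S.q₁ S.q₁) (num 3 (mul₂ (S.deg_b₁ S.p₁) (S.deg_l S.p₁)))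
    have h21 := scaled (S.scaledCubic₂_mem S.p₁ S.p₁ S.p₂) (add_mem (add_mem (num 3 (mul₂ (S.deg_b₁ S.q₁) (S.deg_l S.q₂))) (num 3 (mul₂ (S.deg_b₂ S.q₂) (S.deg_l S.q₂)))) (num 5 (mul₂ (S.deg_b₁ S.q₂) (S.deg_l S.q₁))))
    have h22 := scaled (S.scaledCubic₂_mem S.p₁ S.p₁ S.q₁) (num 2 (mul₂ (S.deg_b₁ S.q₂) (S.deg_l S.p₂)))
    have h23 := scaled (S.scaledCubic₂_mem S.p₁ S.p₂ S.q₁) (add_mem (num 3 (mul₂ (S.deg_b₁ S.p₁) (S.deg_l S.q₂))) (num 5 (mul₂ (S.deg_b₁ S.q₂) (S.deg_l S.p₁))))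
    have h24 := scaled (S.scaledCubic₂_mem S.p₁ S.p₂ S.q₂) (add_mem (sub_mem (sub_mem (num 3 (mul₂ (S.deg_b₁ S.q₁) (S.deg_l S.p₁))) (num 3 (mul₂ (S.deg_b₁ S.p₁) (S.deg_l S.q₁)))) (num 3 (mul₂ (S.deg_b₂ S.p₁) (S.deg_l S.q₂)))) (num 3 (mul₂ (S.deg_b₂ S.q₂) (S.deg_l S.p₁))))
    have h25 := scaled (S.scaledCubic₂_mem S.p₁ S.q₁ S.q₂) (num 6 (mul₂ (S.deg_b₁ S.p₁) (S.deg_l S.p₂)))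
    have h26 := scaled (S.scaledCubic₂_mem S.p₁ S.q₂ S.q₂) (num 3 (mul₂ (S.deg_b₂ S.p₁) (S.deg_l S.p₂)))
    have h27 := scaled (S.scaledCubic₂_mem S.p₂ S.q₂ S.q₂) (num 3 (mul₂ (S.deg_b₂ S.p₁) (S.deg_l S.p₁)))
    have h28 := quartic (S.quartic_mem S.p₁ S.p₁ S.p₂ S.q₁) (num 7 (S.deg_l S.q₂))
    have h29 := quartic (S.quartic_mem S.p₁ S.p₁ S.p₂ S.q₂) (num 7 (S.deg_l S.q₁))
    have h30 := quartic (S.quartic_mem S.p₁ S.p₁ S.q₁ S.q₂) (S.deg_l S.p₂)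
    have h31 := quartic (S.quartic_mem S.p₁ S.p₂ S.q₁ S.q₂) (num 10 (S.deg_l S.p₁))
    exact (sub_mem (add_mem (add_mem (add_mem (sub_mem (add_mem (add_mem (sub_mem (sub_mem (add_mem (add_mem (add_mem (sub_mem (sub_mem (add_mem (sub_mem (sub_mem (sub_mem (sub_mem (sub_mem (sub_mem (add_mem (add_mem (add_mem (add_mem (add_mem (sub_mem (sub_mem (add_mem (sub_mem (sub_mem h0 h1) h2) h3) h4) h5) h6) h7) h8) h9) h10) h11) h12) h13) h14) h15) h16) h17) h18) h19) h20) h21) h22) h23) h24) h25) h26) h27) h28) h29) h30) h31)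
  have := (certSpan f 4).smul_mem (8⁻¹ : ℂ) h
  rwa [smul_eq_C_mul, ← mul_assoc, ← map_ofNat (C : ℂ →+* MvPolynomial σ ℂ) 8, ← C_mul,
    inv_mul_cancel₀ (by norm_num), C_1, one_mul] at this

/-- Conjugating `swapSecond` by `swapFactors` exchanges the basis vectors of the first factor, so
`p₂` takes the place of `p₁`. -/
theorem l_p₂_mem : S.l S.p₂ ∈ certSpan f 4 :=
  S.swapFactors.swapSecond.swapFactors.l_p₁_mem

theorem l_q₁_mem : S.l S.q₁ ∈ certSpan f 4 := S.swapFactors.l_p₁_mem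

theorem l_q₂_mem : S.l S.q₂ ∈ certSpan f 4 := S.swapSecond.swapFactors.l_p₁_mem

/-- At the four dual points each summand of `star` reduces to `± sym2 aᵢ bⱼ`. Multiplied by `c`, it
is `1` modulo a gate relation and values of `l`; the sign of the sign gate makes the four
contributions add up instead of cancelling. -/
theorem four_eq : (4 : MvPolynomial σ ℂ) =
    S.c * S.star S.p₁ S.p₂ S.q₁ S.q₂ -
    (S.gate₁₁ S.p₁ S.q₁ + S.gate₁₂ S.p₁ S.q₂ + S.gate₂₁ S.p₂ S.q₁ - S.gate₂₂ S.p₂ S.q₂) +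
    ((S.α₁ * S.b₁ S.q₁ + S.β₁ * S.a₁ S.q₁ + S.α₁ * S.b₂ S.q₂ + S.β₂ * S.a₁ S.q₂) * S.l S.p₁ +
    (S.α₂ * S.b₁ S.q₁ + S.β₁ * S.a₂ S.q₁ - S.α₂ * S.b₂ S.q₂ - S.β₂ * S.a₂ S.q₂) * S.l S.p₂ +
    (S.α₁ * S.b₁ S.p₁ + S.β₁ * S.a₁ S.p₁ + S.α₂ * S.b₁ S.p₂ + S.β₁ * S.a₂ S.p₂) * S.l S.q₁ +
    (S.α₁ * S.b₂ S.p₁ + S.β₂ * S.a₁ S.p₁ - S.α₂ * S.b₂ S.p₂ - S.β₂ * S.a₂ S.p₂) * S.l S.q₂) := by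
  simp only [gate₁₁, gate₁₂, gate₂₁, gate₂₂, star, gateForm, sym4, sym3, sym2, S.x₁_p₁, S.x₁_p₂,
    S.x₁_q₁, S.x₁_q₂, S.x₂_p₁, S.x₂_p₂, S.x₂_q₁, S.x₂_q₂, S.y₁_p₁, S.y₁_p₂, S.y₁_q₁, S.y₁_q₂,
    S.y₂_p₁, S.y₂_p₂, S.y₂_q₁, S.y₂_q₂]
  ring

theorem one_mem_certSpan (S : SignGate f ι) : (1 : MvPolynomial σ ℂ) ∈ certSpan f 6 := by
  have prod {p q : MvPolynomial σ ℂ} (hp : p ∈ restrictTotalDegree σ ℂ 1)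
      (hq : q ∈ restrictTotalDegree σ ℂ 1) : p * q ∈ restrictTotalDegree σ ℂ 2 :=
    mul_mem_restrictTotalDegree hp hq
  have term {p q : MvPolynomial σ ℂ} (hp : p ∈ restrictTotalDegree σ ℂ 2)
      (hq : q ∈ certSpan f 4) : p * q ∈ certSpan f 6 :=
    mul_mem_certSpan_of_le le_rfl hp hq
  have gate := certSpan_mono f (Nat.zero_le 6)
  have h : (4 : MvPolynomial σ ℂ) ∈ certSpan f 6 := by
    rw [S.four_eq]
    refine add_mem (sub_mem ?_ (sub_mem (add_mem (add_mem (gate (S.gate₁₁_mem _ _))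
      (gate (S.gate₁₂_mem _ _))) (gate (S.gate₂₁_mem _ _))) (gate (S.gate₂₂_mem _ _))))
      (add_mem (add_mem (add_mem (term ?_ S.l_p₁_mem) (term ?_ S.l_p₂_mem)) (term ?_ S.l_q₁_mem))
        (term ?_ S.l_q₂_mem))
    · exact mul_mem_certSpan_of_le (by norm_num) S.deg_c (S.star_mem _ _ _ _)
    · exact add_mem (add_mem (add_mem (prod S.deg_α₁ (S.deg_b₁ _)) (prod S.deg_β₁ (S.deg_a₁ _)))
        (prod S.deg_α₁ (S.deg_b₂ _))) (prod S.deg_β₂ (S.deg_a₁ _))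
    · exact sub_mem (sub_mem (add_mem (prod S.deg_α₂ (S.deg_b₁ _)) (prod S.deg_β₁ (S.deg_a₂ _)))
        (prod S.deg_α₂ (S.deg_b₂ _))) (prod S.deg_β₂ (S.deg_a₂ _))
    · exact add_mem (add_mem (add_mem (prod S.deg_α₁ (S.deg_b₁ _)) (prod S.deg_β₁ (S.deg_a₁ _)))
        (prod S.deg_α₂ (S.deg_b₁ _))) (prod S.deg_β₁ (S.deg_a₂ _))
    · exact sub_mem (sub_mem (add_mem (prod S.deg_α₁ (S.deg_b₂ _)) (prod S.deg_β₂ (S.deg_a₁ _)))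
        (prod S.deg_α₂ (S.deg_b₂ _))) (prod S.deg_β₂ (S.deg_a₂ _))
  have := (certSpan f 6).smul_mem (4⁻¹ : ℂ) h
  rwa [smul_eq_C_mul, ← map_ofNat (C : ℂ →+* MvPolynomial σ ℂ) 4, ← C_mul,
    inv_mul_cancel₀ (by norm_num), C_1] at this

end SignGate

end SignGate

/-! ### Closed forms of the heralded polynomial for zero and one photon. -/

section ClosedForm

variable {M : ℕ} {R : Type*} [CommRing R]

/-- The linear form with coefficients `f`. -/
noncomputable def linForm {τ : Type*} [Fintype τ] (f : τ → R) : MvPolynomial τ R :=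
  ∑ j, C (f j) * X j

theorem linForm_single {τ : Type*} [Fintype τ] [DecidableEq τ] (i : τ) :
    linForm (Pi.single i (1 : R)) = X i := by
  rw [linForm, Finset.sum_eq_single i] <;> simp +contextual [Pi.single_eq_of_ne]

theorem pderiv_linForm {τ : Type*} [Fintype τ] (f : τ → R) (i : τ) :
    pderiv i (linForm f) = C (f i) := by
  classical
  simp [linForm, Derivation.leibniz, pderiv_X, Pi.single_apply]

theorem coeff_single_linForm {τ : Type*} [Fintype τ] (f : τ → R) (i : τ) :
    coeff (Finsupp.single i 1) (linForm f) = f i := by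
  classical
  simp [linForm, coeff_sum, coeff_C_mul, coeff_X, Finsupp.single_left_inj]

/-- The coefficients of a product of two linear forms in terms of its polarization. -/
theorem coeff_linForm_mul_linForm {τ : Type*} [Fintype τ] [DecidableEq τ] (f g : τ → R) (i j : τ) :
    (if i = j then 2 else 1) * coeff (Finsupp.single i 1 + Finsupp.single j 1)
      (linForm f * linForm g) = sym2 f g i j := by
  -- The coefficient of `X i` in the `j`-th derivative is the polarization; differentiating a square
  -- produces the factor 2 on the diagonal.
  have h := coeff_pderiv (i := j) (linForm f * linForm g) (Finsupp.single i 1)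
  rw [Derivation.leibniz, pderiv_linForm, pderiv_linForm, smul_eq_mul, smul_eq_mul, coeff_add,
    mul_comm, mul_comm (linForm g), coeff_C_mul, coeff_C_mul, coeff_single_linForm, coeff_single_linForm] at h
  rw [show sym2 f g i j = g j * f i + f j * g i by rw [sym2, mul_comm (f i)], h, mul_comm]
  by_cases hij : i = j
  · subst hij
    simp
    norm_num
  · simp [hij]

/-- The mode of the control photon. -/
def controlMode (c : Bool) : Fin 4 := if c then 1 else 0

/-- The mode of the target photon. -/
def targetMode (t : Bool) : Fin 4 := if t then 3 else 2

theorem fockPoly_dualRail (c t : Bool) :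
    fockPoly (dualRail c t) = X (controlMode c) * X (targetMode t) := by
  cases c <;> cases t <;>
    simp [fockPoly, dualRail, controlMode, targetMode, Fin.prod_univ_four]

theorem fockPoly_sumElim {ι κ : Type*} [Fintype ι] [Fintype κ] (s : ι → ℕ) (t : κ → ℕ) :
    fockPoly (Sum.elim s t) = rename Sum.inl (fockPoly s) * rename Sum.inr (fockPoly t) := by
  simp [fockPoly, Fintype.prod_sum_type, map_prod]

theorem fockPoly_single {ι : Type*} [Fintype ι] [DecidableEq ι] (i : ι) :
    fockPoly (Pi.single i 1) = X i := by
  rw [fockPoly, Finset.prod_eq_single i] <;> simp +contextual [Pi.single_eq_of_ne]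

theorem fockPoly_zero {ι : Type*} [Fintype ι] : fockPoly (0 : ι → ℕ) = 1 := by
  simp [fockPoly]

theorem heraldDeriv_single {τ : Type*} (k : Fin M) (F : MvPolynomial (τ ⊕ Fin M) R) :
    heraldDeriv (Pi.single k 1) F = pderiv (Sum.inr k) F := by
  have h : ∀ L : List (Fin M), L.Nodup →
      L.foldr (fun j P => (pderiv (Sum.inr j : τ ⊕ Fin M))^[(Pi.single k 1 : Fin M → ℕ) j] P) F =
        if k ∈ L then pderiv (Sum.inr k) F else F := by
    intro L hL
    induction L with
    | nil => simp
    | cons a L ih =>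
      rw [List.nodup_cons] at hL
      rw [List.foldr_cons, ih hL.2]
      by_cases ha : a = k
      · subst ha
        simp [hL.1]
      · simp [Ne.symm ha]
  rw [heraldDeriv, h _ (List.nodup_finRange M), if_pos (List.mem_finRange k)]

theorem heraldDeriv_zero {τ : Type*} (F : MvPolynomial (τ ⊕ Fin M) R) :
    heraldDeriv (0 : Fin M → ℕ) F = F := by
  have h : ∀ L : List (Fin M),
      L.foldr (fun j P => (pderiv (Sum.inr j : τ ⊕ Fin M))^[(0 : Fin M → ℕ) j] P) F = F := by
    intro L
    induction L with
    | nil => simp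
    | cons a L ih => rw [List.foldr_cons, ih]; simp
  exact h _

theorem aeval_linForm (f : Fin 4 ⊕ Fin M → R) :
    aeval (Sum.elim (fun i => (X i : MvPolynomial (Fin 4) R)) (fun _ => 0)) (linForm f) =
      linForm (fun j => f (Sum.inl j)) := by
  simp [linForm, algebraMap_eq]

variable [Algebra ℂ R]

theorem evolve_X {ι : Type*} [Fintype ι] (A : Matrix ι ι R) (i : ι) :
    evolve A (X i) = linForm (A i) := by
  simp [evolve, linForm]

/-- The heralded polynomial with a single ancilla photon in mode `j` and a single heralding photon
in mode `k`. -/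
theorem gatePoly_single (A : Matrix (Fin 4 ⊕ Fin M) (Fin 4 ⊕ Fin M) R) (j k : Fin M) (c t : Bool) :
    gatePoly A (Pi.single j 1) (Pi.single k 1) c t =
      C (A (Sum.inl (controlMode c)) (Sum.inr k)) *
          (linForm (fun i => A (Sum.inr j) (Sum.inl i)) *
            linForm (fun i => A (Sum.inl (targetMode t)) (Sum.inl i))) +
        C (A (Sum.inl (targetMode t)) (Sum.inr k)) *
          (linForm (fun i => A (Sum.inr j) (Sum.inl i)) *
            linForm (fun i => A (Sum.inl (controlMode c)) (Sum.inl i))) +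
        C (A (Sum.inr j) (Sum.inr k)) *
          (linForm (fun i => A (Sum.inl (controlMode c)) (Sum.inl i)) *
            linForm (fun i => A (Sum.inl (targetMode t)) (Sum.inl i))) := by
  have hfac : (∏ i, ((Pi.single k 1 : Fin M → ℕ) i).factorial : ℂ) = 1 :=
    Finset.prod_eq_one fun i _ => by by_cases h : i = k <;> simp [h]
  have hmul (P Q : MvPolynomial (Fin 4 ⊕ Fin M) ℂ) : evolve A (P * Q) = evolve A P * evolve A Q :=
    map_mul _ P Q
  rw [gatePoly, heraldPoly, hfac, inv_one, one_smul, heraldDeriv_single, fockPoly_sumElim,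
    fockPoly_dualRail, fockPoly_single, map_mul, rename_X, rename_X, rename_X, hmul, hmul, evolve_X,
    evolve_X, evolve_X, Derivation.leibniz, Derivation.leibniz, pderiv_linForm, pderiv_linForm,
    pderiv_linForm]
  simp only [smul_eq_mul, map_add, map_mul, aeval_linForm, algHom_C, algebraMap_eq]
  ring

/-- The heralded polynomial without ancilla and heralding photons. -/
theorem gatePoly_zero (A : Matrix (Fin 4 ⊕ Fin M) (Fin 4 ⊕ Fin M) R) (c t : Bool) :
    gatePoly A 0 0 c t = linForm (fun i => A (Sum.inl (controlMode c)) (Sum.inl i)) *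
      linForm (fun i => A (Sum.inl (targetMode t)) (Sum.inl i)) := by
  have hmul (P Q : MvPolynomial (Fin 4 ⊕ Fin M) ℂ) : evolve A (P * Q) = evolve A P * evolve A Q :=
    map_mul _ P Q
  rw [gatePoly, heraldPoly, heraldDeriv_zero, fockPoly_sumElim, fockPoly_dualRail, fockPoly_zero,
    map_mul, rename_X, rename_X, map_one, mul_one, hmul, evolve_X, evolve_X, map_mul, aeval_linForm,
    aeval_linForm]
  simp

end ClosedForm

/-! ### The CNOT system as a sign gate. -/

section CnotSystem

/-- The value at the point `v` of the linear form with coefficients `f`. -/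
noncomputable def evalForm {σ : Type*} (f : Fin 4 → MvPolynomial σ ℂ) (v : Fin 4 → ℂ) :
    MvPolynomial σ ℂ :=
  ∑ k, C (v k) * f k

theorem evalForm_mem {σ : Type*} {f : Fin 4 → MvPolynomial σ ℂ} {d : ℕ}
    (hf : ∀ k, f k ∈ restrictTotalDegree σ ℂ d) (v : Fin 4 → ℂ) :
    evalForm f v ∈ restrictTotalDegree σ ℂ d :=
  sum_mem fun k _ => by
    rw [← smul_eq_C_mul]
    exact Submodule.smul_mem _ _ (hf k)

/-- Bilinearity carries relations from pairs of modes to arbitrary points, such as those dual to the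
rotated target basis. -/
theorem sym2_evalForm {σ : Type*} (f g : Fin 4 → MvPolynomial σ ℂ) (v w : Fin 4 → ℂ) :
    sym2 (evalForm f) (evalForm g) v w =
      ∑ j, ∑ k, (v j * w k) • sym2 f g j k := by
  simp only [sym2, evalForm, Fin.sum_univ_four, smul_eq_C_mul, C_mul]
  ring

theorem gateForm_evalForm {σ : Type*} (α β c : MvPolynomial σ ℂ)
    (a b l : Fin 4 → MvPolynomial σ ℂ) (v w : Fin 4 → ℂ) :
    gateForm α β c (evalForm a) (evalForm b) (evalForm l) v w =
      ∑ j, ∑ k, (v j * w k) • gateForm α β c a b l j k := by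
  simp only [gateForm, sym2_evalForm, smul_add, Finset.sum_add_distrib, Finset.mul_sum,
    mul_smul_comm]

/-- The positions of the entries of the unknown matrix, which index the variables. -/
abbrev CnotVar : Type := (Fin 4 ⊕ Fin 1) × (Fin 4 ⊕ Fin 1)

/-- The target columns of row `i` of the unknown matrix. -/
noncomputable def unknownRow (i : Fin 4 ⊕ Fin 1) (k : Fin 4) : MvPolynomial CnotVar ℂ :=
  X (i, Sum.inl k)

/-- The heralding column of the unknown matrix. -/
noncomputable def unknownCol (i : Fin 4 ⊕ Fin 1) : MvPolynomial CnotVar ℂ := X (i, Sum.inr 0)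

/-- The exponent of the monomial `X i * X j`. -/
noncomputable def pairExponent (i j : Fin 4) :
    Finset.finsuppAntidiag (Finset.univ : Finset (Fin 4)) 2 :=
  ⟨Finsupp.single i 1 + Finsupp.single j 1, by
    rw [Finset.mem_finsuppAntidiag]
    exact ⟨by simp [Finset.sum_add_distrib, Finsupp.single_apply], Finset.subset_univ _⟩⟩

/-- Every equation of the system is thereby reached by `gateForm_sub_eq`, which bounds its degree.
-/
theorem exists_eq_pairExponent (e : Finset.finsuppAntidiag (Finset.univ : Finset (Fin 4)) 2) :
    ∃ i j, e = pairExponent i j := by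
  obtain ⟨e, he⟩ := e
  rw [Finset.mem_finsuppAntidiag] at he
  have key : ∀ (d : Fin 4 →₀ ℕ) (n : ℕ), ∑ i, d i = n + 1 →
      ∃ (i : Fin 4) (d' : Fin 4 →₀ ℕ), d = Finsupp.single i 1 + d' ∧ ∑ i, d' i = n := by
    intro d n hd
    obtain ⟨i, -, hi⟩ := Finset.exists_ne_zero_of_sum_ne_zero (hd.trans_ne n.succ_ne_zero)
    have h : d = Finsupp.single i 1 + (d - Finsupp.single i 1) :=
      (add_tsub_cancel_of_le (by simpa [Nat.one_le_iff_ne_zero] using hi)).symm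
    refine ⟨i, d - Finsupp.single i 1, h, ?_⟩
    rw [h] at hd
    simp only [Finsupp.add_apply, Finset.sum_add_distrib, Finsupp.single_apply,
      Finset.sum_ite_eq, Finset.mem_univ, if_true] at hd
    omega
  obtain ⟨i, d, rfl, hd⟩ := key e 1 he.1
  obtain ⟨j, d', rfl, hd'⟩ := key d 0 hd
  have h0 : d' = 0 := by
    ext k
    exact Finset.sum_eq_zero_iff.mp hd' k (Finset.mem_univ k)
  subst h0
  exact ⟨i, j, by simp [pairExponent]⟩

theorem one_eq_single : (fun _ => 1 : Fin 1 → ℕ) = Pi.single 0 1 := by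
  ext i
  fin_cases i
  simp

/-- The polarized form of the equations of the system. -/
theorem gateForm_sub_eq (γ : ℂ) (c t : Bool) (i j : Fin 4) :
    gateForm (unknownCol (Sum.inl (controlMode c))) (unknownCol (Sum.inl (targetMode t)))
        (C γ * unknownCol (Sum.inr 0)) (unknownRow (Sum.inl (controlMode c)))
        (unknownRow (Sum.inl (targetMode t))) (fun k => C γ * unknownRow (Sum.inr 0) k) i j -
      sym2 (Pi.single (controlMode c) 1) (Pi.single (targetMode (xor c t)) 1) i j =
    (if i = j then 2 else 1) * cnotSystem γ ((c, t), pairExponent i j) := by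
  have hQ := congr_arg (C (σ := CnotVar)) (coeff_linForm_mul_linForm (Pi.single (controlMode c) (1 : ℂ))
    (Pi.single (targetMode (xor c t)) 1) i j)
  rw [linForm_single, linForm_single, ← fockPoly_dualRail] at hQ
  have h1 (f g : Fin 4 → MvPolynomial CnotVar ℂ) := coeff_linForm_mul_linForm f g i j
  have hS : C (σ := CnotVar) (sym2 (Pi.single (controlMode c) (1 : ℂ))
      (Pi.single (targetMode (xor c t)) 1) i j) =
      sym2 (Pi.single (controlMode c) 1) (Pi.single (targetMode (xor c t)) 1) i j := by
    simp only [sym2, C_add, C_mul, Pi.single_apply, apply_ite C, C_1, C_0]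
  have hif : C (σ := CnotVar) (if i = j then 2 else 1 : ℂ) = if i = j then 2 else 1 := by
    split_ifs
    · exact map_ofNat C 2
    · exact C_1
  have hr (i : Fin 4 ⊕ Fin 1) : unknownRow i = fun k => X (i, Sum.inl k) := rfl
  have hl (g : Fin 4 → MvPolynomial CnotVar ℂ) :
      sym2 (fun k => C γ * unknownRow (Sum.inr 0) k) g i j =
        C γ * sym2 (unknownRow (Sum.inr 0)) g i j := by
    simp only [sym2]; ring
  rw [C_mul, hif, hS] at hQ
  rw [← hQ, gateForm, hl, hl, ← h1, ← h1, ← h1, cnotSystem, one_eq_single, gatePoly_single]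
  simp only [pairExponent, coeff_add, coeff_C_mul, Matrix.mvPolynomialX_apply]
  simp only [unknownCol, hr]
  ring

theorem gateForm_sub_mem (γ : ℂ) (c t : Bool) (v w : Fin 4 → ℂ) :
    gateForm (unknownCol (Sum.inl (controlMode c))) (unknownCol (Sum.inl (targetMode t)))
        (C γ * unknownCol (Sum.inr 0)) (evalForm (unknownRow (Sum.inl (controlMode c))))
        (evalForm (unknownRow (Sum.inl (targetMode t))))
        (evalForm fun k => C γ * unknownRow (Sum.inr 0) k) v w -
      sym2 (evalForm (Pi.single (controlMode c) 1))
        (evalForm (Pi.single (targetMode (xor c t)) 1)) v w ∈ certSpan (cnotSystem γ) 0 := by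
  rw [gateForm_evalForm, sym2_evalForm, ← Finset.sum_sub_distrib]
  refine sum_mem fun i _ => ?_
  rw [← Finset.sum_sub_distrib]
  refine sum_mem fun j _ => ?_
  rw [← smul_sub, gateForm_sub_eq]
  refine Submodule.smul_mem _ _ ?_
  have h := mem_certSpan_zero (cnotSystem γ) ((c, t), pairExponent i j)
  split_ifs
  · rw [two_mul]
    exact add_mem h h
  · rwa [one_mul]

theorem unknownRow_mem (i : Fin 4 ⊕ Fin 1) (k : Fin 4) :
    unknownRow i k ∈ restrictTotalDegree CnotVar ℂ 1 := by
  rw [mem_restrictTotalDegree]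
  exact (totalDegree_X _).le

theorem unknownCol_mem (i : Fin 4 ⊕ Fin 1) : unknownCol i ∈ restrictTotalDegree CnotVar ℂ 1 := by
  rw [mem_restrictTotalDegree]
  exact (totalDegree_X _).le

theorem C_mul_mem_restrictTotalDegree {σ : Type*} {d : ℕ} {p : MvPolynomial σ ℂ} (c : ℂ)
    (hp : p ∈ restrictTotalDegree σ ℂ d) : C c * p ∈ restrictTotalDegree σ ℂ d := by
  rw [← smul_eq_C_mul]
  exact Submodule.smul_mem _ c hp

theorem single_mem_restrictTotalDegree {σ : Type*} (i k : Fin 4) :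
    (Pi.single i 1 : Fin 4 → MvPolynomial σ ℂ) k ∈ restrictTotalDegree σ ℂ 0 := by
  rw [mem_restrictTotalDegree, Pi.single_apply]
  split_ifs <;> simp

theorem totalDegree_cnotSystem_le (γ : ℂ)
    (p : (Bool × Bool) × (Finset.finsuppAntidiag (Finset.univ : Finset (Fin 4)) 2)) :
    (cnotSystem γ p).totalDegree ≤ 3 := by
  obtain ⟨⟨c, t⟩, e⟩ := p
  obtain ⟨i, j, rfl⟩ := exists_eq_pairExponent e
  rw [← mem_restrictTotalDegree]
  have h := gateForm_sub_eq γ c t i j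
  have hg := SignGate.gateForm_mem (unknownRow_mem (Sum.inl (controlMode c)))
    (unknownRow_mem (Sum.inl (targetMode t)))
    (fun k => C_mul_mem_restrictTotalDegree γ (unknownRow_mem (Sum.inr 0) k))
    (unknownCol_mem (Sum.inl (controlMode c))) (unknownCol_mem (Sum.inl (targetMode t)))
    (C_mul_mem_restrictTotalDegree γ (unknownCol_mem (Sum.inr 0))) i j
  have hs := SignGate.sym2_mem (σ := CnotVar) (single_mem_restrictTotalDegree (controlMode c))
    (single_mem_restrictTotalDegree (targetMode (xor c t))) i j
  rw [mem_restrictTotalDegree] at hs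
  have hm := sub_mem hg ((mem_restrictTotalDegree _ _ _).mpr (hs.trans (Nat.zero_le 3)))
  rw [h] at hm
  split_ifs at hm
  · have := Submodule.smul_mem _ (2⁻¹ : ℂ) hm
    rwa [smul_eq_C_mul, ← mul_assoc, ← map_ofNat (C : ℂ →+* MvPolynomial CnotVar ℂ) 2, ← C_mul,
      inv_mul_cancel₀ two_ne_zero, C_1, one_mul] at this
  · rwa [one_mul] at hm

/-- In the basis `X 2 ± X 3` of the target modes, the controlled-not gate becomes a sign gate. -/
noncomputable def cnotSignGate (γ : ℂ) : SignGate (cnotSystem γ) (Fin 4 → ℂ) where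
  a₁ := evalForm (unknownRow (Sum.inl 0))
  a₂ := evalForm (unknownRow (Sum.inl 1))
  b₁ v := C 2⁻¹ * (evalForm (unknownRow (Sum.inl 2)) v + evalForm (unknownRow (Sum.inl 3)) v)
  b₂ v := C 2⁻¹ * (evalForm (unknownRow (Sum.inl 2)) v - evalForm (unknownRow (Sum.inl 3)) v)
  l := evalForm fun k => C γ * unknownRow (Sum.inr 0) k
  x₁ := evalForm (Pi.single 0 1)
  x₂ := evalForm (Pi.single 1 1)
  y₁ v := C 2⁻¹ * (evalForm (Pi.single 2 1) v + evalForm (Pi.single 3 1) v)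
  y₂ v := C 2⁻¹ * (evalForm (Pi.single 2 1) v - evalForm (Pi.single 3 1) v)
  α₁ := unknownCol (Sum.inl 0)
  α₂ := unknownCol (Sum.inl 1)
  β₁ := C 2⁻¹ * (unknownCol (Sum.inl 2) + unknownCol (Sum.inl 3))
  β₂ := C 2⁻¹ * (unknownCol (Sum.inl 2) - unknownCol (Sum.inl 3))
  c := C γ * unknownCol (Sum.inr 0)
  -- Dual to `x₁`, `x₂`, `y₁`, `y₂`: the factor `1/2` in `y₁` and `y₂` gives the value 1 at `(0, 0,
  -- 1, 1)` and `(0, 0, 1, -1)`.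
  p₁ := ![1, 0, 0, 0]
  p₂ := ![0, 1, 0, 0]
  q₁ := ![0, 0, 1, 1]
  q₂ := ![0, 0, 1, -1]
  deg_a₁ := evalForm_mem (unknownRow_mem _)
  deg_a₂ := evalForm_mem (unknownRow_mem _)
  deg_b₁ v := C_mul_mem_restrictTotalDegree _
    (add_mem (evalForm_mem (unknownRow_mem _) v) (evalForm_mem (unknownRow_mem _) v))
  deg_b₂ v := C_mul_mem_restrictTotalDegree _
    (sub_mem (evalForm_mem (unknownRow_mem _) v) (evalForm_mem (unknownRow_mem _) v))
  deg_l := evalForm_mem fun k => C_mul_mem_restrictTotalDegree γ (unknownRow_mem _ k)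
  deg_x₁ := evalForm_mem (single_mem_restrictTotalDegree _)
  deg_x₂ := evalForm_mem (single_mem_restrictTotalDegree _)
  deg_y₁ v := C_mul_mem_restrictTotalDegree _ (add_mem
    (evalForm_mem (single_mem_restrictTotalDegree _) v)
    (evalForm_mem (single_mem_restrictTotalDegree _) v))
  deg_y₂ v := C_mul_mem_restrictTotalDegree _ (sub_mem
    (evalForm_mem (single_mem_restrictTotalDegree _) v)
    (evalForm_mem (single_mem_restrictTotalDegree _) v))
  deg_α₁ := unknownCol_mem _
  deg_α₂ := unknownCol_mem _
  deg_β₁ := C_mul_mem_restrictTotalDegree _ (add_mem (unknownCol_mem _) (unknownCol_mem _))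
  deg_β₂ := C_mul_mem_restrictTotalDegree _ (sub_mem (unknownCol_mem _) (unknownCol_mem _))
  deg_c := C_mul_mem_restrictTotalDegree _ (unknownCol_mem _)
  x₁_p₁ := by simp [evalForm, Fin.sum_univ_four]
  x₁_p₂ := by simp [evalForm, Fin.sum_univ_four]
  x₁_q₁ := by simp [evalForm, Fin.sum_univ_four]
  x₁_q₂ := by simp [evalForm, Fin.sum_univ_four]
  x₂_p₁ := by simp [evalForm, Fin.sum_univ_four]
  x₂_p₂ := by simp [evalForm, Fin.sum_univ_four]
  x₂_q₁ := by simp [evalForm, Fin.sum_univ_four]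
  x₂_q₂ := by simp [evalForm, Fin.sum_univ_four]
  y₁_p₁ := by simp [evalForm, Fin.sum_univ_four]
  y₁_p₂ := by simp [evalForm, Fin.sum_univ_four]
  y₁_q₁ := by simp [evalForm, Fin.sum_univ_four, ← C_1, ← C_add, ← C_mul, -map_one, -map_add,
    -map_mul]; norm_num
  y₁_q₂ := by simp [evalForm, Fin.sum_univ_four]
  y₂_p₁ := by simp [evalForm, Fin.sum_univ_four]
  y₂_p₂ := by simp [evalForm, Fin.sum_univ_four]
  y₂_q₁ := by simp [evalForm, Fin.sum_univ_four]
  y₂_q₂ := by simp [evalForm, Fin.sum_univ_four, ← C_1, ← C_add, ← C_mul, -map_one, -map_add,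
    -map_mul]; norm_num
  -- Half the sum and half the difference over `t` pass to the rotated basis. For control bit 1 the
  -- flip of `t` fixes the sum and negates the difference, hence the sign in `mem₂₂`.
  mem₁₁ v w := by
    convert Submodule.smul_mem _ (2⁻¹ : ℂ) (add_mem (gateForm_sub_mem γ false false v w)
      (gateForm_sub_mem γ false true v w)) using 1
    simp only [smul_eq_C_mul, gateForm, sym2, controlMode, targetMode, Bool.xor_true,
      Bool.xor_false, Bool.not_false, if_true, Bool.false_eq_true, if_false]
    ring
  mem₁₂ v w := by
    convert Submodule.smul_mem _ (2⁻¹ : ℂ) (sub_mem (gateForm_sub_mem γ false false v w)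
      (gateForm_sub_mem γ false true v w)) using 1
    simp only [smul_eq_C_mul, gateForm, sym2, controlMode, targetMode, Bool.xor_true,
      Bool.xor_false, Bool.not_false, if_true, Bool.false_eq_true, if_false]
    ring
  mem₂₁ v w := by
    convert Submodule.smul_mem _ (2⁻¹ : ℂ) (add_mem (gateForm_sub_mem γ true false v w)
      (gateForm_sub_mem γ true true v w)) using 1
    simp only [smul_eq_C_mul, gateForm, sym2, controlMode, targetMode, Bool.xor_true,
      Bool.xor_false, Bool.not_true, if_true, Bool.false_eq_true, if_false]
    ring
  mem₂₂ v w := by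
    convert Submodule.smul_mem _ (2⁻¹ : ℂ) (sub_mem (gateForm_sub_mem γ true false v w)
      (gateForm_sub_mem γ true true v w)) using 1
    simp only [smul_eq_C_mul, gateForm, sym2, controlMode, targetMode, Bool.xor_true,
      Bool.xor_false, Bool.not_true, if_true, Bool.false_eq_true, if_false]
    ring

theorem one_mem_certSpan_cnotSystem (γ : ℂ) :
    (1 : MvPolynomial CnotVar ℂ) ∈ certSpan (cnotSystem γ) 6 :=
  (cnotSignGate γ).one_mem_certSpan

theorem hasNullstellensatzCertificate_cnotSystem (γ : ℂ) :
    HasNullstellensatzCertificate (cnotSystem γ) 6 := by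
  have : Nonempty (Finset.finsuppAntidiag (Finset.univ : Finset (Fin 4)) 2) :=
    ⟨pairExponent 0 0⟩
  exact hasNullstellensatzCertificate_of_one_mem
    (fun p => (totalDegree_cnotSystem_le γ p).trans (by norm_num)) (one_mem_certSpan_cnotSystem γ)

end CnotSystem

/-! ### Photon counting. -/

section Homogeneity

variable {M : ℕ}

theorem fockPoly_isHomogeneous {ι : Type*} [Fintype ι] (s : ι → ℕ) :
    (fockPoly s).IsHomogeneous (∑ i, s i) :=
  IsHomogeneous.prod _ _ _ fun _ _ => isHomogeneous_C_mul_X_pow _ _ _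

theorem evolve_isHomogeneous {ι : Type*} [Fintype ι] (A : Matrix ι ι ℂ) {P : MvPolynomial ι ℂ}
    {n : ℕ} (hP : P.IsHomogeneous n) : (evolve A P).IsHomogeneous n := by
  have h := hP.aeval (fun i => ∑ j, C (A i j) * X j)
    fun i => IsHomogeneous.sum _ _ 1 fun j _ => isHomogeneous_C_mul_X (A i j) j
  rwa [one_mul] at h

/-- Truncated subtraction is harmless: differentiating a constant gives zero, which is homogeneous
of every degree. -/
theorem heraldDeriv_isHomogeneous {τ : Type*} (m : Fin M → ℕ)
    {F : MvPolynomial (τ ⊕ Fin M) ℂ} {n : ℕ} (hF : F.IsHomogeneous n) :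
    (heraldDeriv m F).IsHomogeneous (n - ∑ j, m j) := by
  have hiter (j : Fin M) (k : ℕ) {P : MvPolynomial (τ ⊕ Fin M) ℂ} {d : ℕ}
      (hP : P.IsHomogeneous d) : ((pderiv (Sum.inr j))^[k] P).IsHomogeneous (d - k) := by
    induction k with
    | zero => exact hP
    | succ k ih =>
      rw [Function.iterate_succ_apply', ← Nat.sub_sub]
      exact ih.pderiv
  have h : ∀ L : List (Fin M),
      (L.foldr (fun j P => (pderiv (Sum.inr j : τ ⊕ Fin M))^[m j] P) F).IsHomogeneous
        (n - (L.map m).sum) := by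
    intro L
    induction L with
    | nil => exact hF
    | cons a L ih =>
      rw [List.foldr_cons, List.map_cons, List.sum_cons, add_comm, ← Nat.sub_sub]
      exact hiter a (m a) ih
  rw [← List.sum_ofFn, List.ofFn_eq_map]
  exact h _

theorem gatePoly_isHomogeneous (A : Matrix (Fin 4 ⊕ Fin M) (Fin 4 ⊕ Fin M) ℂ) (anc m : Fin M → ℕ)
    (c t : Bool) : (gatePoly A anc m c t).IsHomogeneous (2 + ∑ j, anc j - ∑ j, m j) := by
  have hs : ∑ i, (Sum.elim (dualRail c t) anc) i = 2 + ∑ j, anc j := by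
    rw [Fintype.sum_sum_type]
    cases c <;> cases t <;> simp [dualRail, Fin.sum_univ_four]
  have h := heraldDeriv_isHomogeneous m (evolve_isHomogeneous A
    (fockPoly_isHomogeneous (Sum.elim (dualRail c t) anc)))
  rw [hs] at h
  have h' := h.aeval (n := 1)
    (Sum.elim (fun i => (X i : MvPolynomial (Fin 4) ℂ)) (fun _ => 0)) (by
      rintro (i | i)
      · exact isHomogeneous_X _ _
      · exact isHomogeneous_zero _ _ _)
  rw [one_mul] at h'
  rw [gatePoly, heraldPoly, smul_eq_C_mul]
  exact h'.C_mul _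

end Homogeneity

/-! ### Impossibility with fewer than two photons. -/

section Impossibility

variable {M : ℕ}

theorem map_linForm {R S τ : Type*} [CommRing R] [CommRing S] [Fintype τ] (φ : R →+* S)
    (f : τ → R) : map φ (linForm f) = linForm fun i => φ (f i) := by
  simp [linForm]

/-- The closed form is the same expression in the matrix entries over every algebra, so it commutes
with specialization. -/
theorem map_gatePoly_unknownMatrix (A : Matrix (Fin 4 ⊕ Fin 1) (Fin 4 ⊕ Fin 1) ℂ) (c t : Bool) :
    map (eval fun p => A p.1 p.2) (gatePoly unknownMatrix (fun _ => 1) (fun _ => 1) c t) =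
      gatePoly A (fun _ => 1) (fun _ => 1) c t := by
  simp only [one_eq_single, gatePoly_single, map_add, map_mul, map_linForm, map_C,
    Matrix.mvPolynomialX_apply, eval_X]

theorem not_isHeraldedCNOT_one (A : Matrix (Fin 4 ⊕ Fin 1) (Fin 4 ⊕ Fin 1) ℂ) (γ : ℂ) :
    ¬ IsHeraldedCNOT A γ (fun _ => 1) (fun _ => 1) := by
  intro h
  obtain ⟨β, hβ, -⟩ := hasNullstellensatzCertificate_cnotSystem γ
  have h0 (p) : eval (fun p => A p.1 p.2) (cnotSystem γ p) = 0 := by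
    rw [cnotSystem, map_sub, map_mul, eval_C, eval_C, ← coeff_map, map_gatePoly_unknownMatrix,
      ← coeff_C_mul, h, sub_self]
  -- At a solution every equation vanishes, and the certificate reads `0 = 1`.
  have h1 := congr_arg (eval fun p => A p.1 p.2) hβ
  simp [map_sum, h0] at h1

/-- Only the ancilla row `j` and the heralding column `k` enter the closed form, so the other
ancilla modes can be deleted. -/
theorem not_isHeraldedCNOT_single (A : Matrix (Fin 4 ⊕ Fin M) (Fin 4 ⊕ Fin M) ℂ) (γ : ℂ)
    (j k : Fin M) : ¬ IsHeraldedCNOT A γ (Pi.single j 1) (Pi.single k 1) := by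
  intro h
  refine not_isHeraldedCNOT_one
    (A.submatrix (Sum.map id fun _ => j) (Sum.map id fun _ => k)) γ fun c t => ?_
  rw [← h c t, one_eq_single, gatePoly_single, gatePoly_single]
  simp only [Matrix.submatrix_apply, Sum.map_inl, Sum.map_inr, id]

/-- An ancilla photon passing straight into the herald gives `α = β = 0`, `l = 0` and `c = 1`, so a
gate without ancilla photons would also be a five-mode gate. -/
theorem not_isHeraldedCNOT_zero (A : Matrix (Fin 4 ⊕ Fin M) (Fin 4 ⊕ Fin M) ℂ) (γ : ℂ) :
    ¬ IsHeraldedCNOT A γ 0 0 := by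
  intro h
  refine not_isHeraldedCNOT_one (Matrix.fromBlocks A.toBlocks₁₁ 0 0 1) γ fun c t => ?_
  rw [← h c t, one_eq_single, gatePoly_single, gatePoly_zero]
  simp [Matrix.toBlocks₁₁]

theorem exists_eq_single_of_sum_eq_one {m : Fin M → ℕ} (h : ∑ j, m j = 1) :
    ∃ k, m = Pi.single k 1 := by
  obtain ⟨k, -, hk⟩ := Finset.exists_ne_zero_of_sum_ne_zero (h.trans_ne one_ne_zero)
  have hs := Finset.add_sum_erase Finset.univ m (Finset.mem_univ k)
  rw [h] at hs
  have h0 : ∑ j ∈ Finset.univ.erase k, m j = 0 := by omega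
  refine ⟨k, funext fun j => ?_⟩
  by_cases hj : j = k
  · subst hj
    rw [Pi.single_eq_same]
    omega
  · rw [Pi.single_eq_of_ne hj]
    exact Finset.sum_eq_zero_iff.mp h0 j (by simp [hj])

theorem two_le_of_isHeraldedCNOT {A : Matrix (Fin 4 ⊕ Fin M) (Fin 4 ⊕ Fin M) ℂ} {γ : ℂ}
    {anc m : Fin M → ℕ} (h : IsHeraldedCNOT A γ anc m) : 2 ≤ ∑ j, anc j ∧ 2 ≤ ∑ j, m j := by
  have hQ : fockPoly (dualRail false false) ≠ 0 := by
    rw [fockPoly_dualRail]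
    exact mul_ne_zero (X_ne_zero _) (X_ne_zero _)
  have hdeg := (gatePoly_isHomogeneous A anc m false false).C_mul γ
  rw [h false false, Bool.xor_false] at hdeg
  have h2 : (fockPoly (dualRail false false)).IsHomogeneous 2 := by
    have := fockPoly_isHomogeneous (dualRail false false)
    rwa [show ∑ i, dualRail false false i = 2 by simp [dualRail, Fin.sum_univ_four]] at this
  -- Comparing degrees gives `2 + ∑ anc - ∑ m = 2`; this value is positive, so the subtraction is
  -- not truncated.
  have hsum : ∑ j, anc j = ∑ j, m j := by
    have := hdeg.inj_right h2 hQ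
    omega
  have hm : 2 ≤ ∑ j, m j := by
    by_contra hlt
    have hcases : ∑ j, m j = 0 ∨ ∑ j, m j = 1 := by omega
    rcases hcases with h0 | h1
    · have hm0 : m = 0 := funext fun j => Finset.sum_eq_zero_iff.mp h0 j (Finset.mem_univ j)
      have ha0 : anc = 0 :=
        funext fun j => Finset.sum_eq_zero_iff.mp (hsum.trans h0) j (Finset.mem_univ j)
      rw [hm0, ha0] at h
      exact not_isHeraldedCNOT_zero A γ h
    · obtain ⟨k, rfl⟩ := exists_eq_single_of_sum_eq_one h1
      obtain ⟨j, rfl⟩ := exists_eq_single_of_sum_eq_one (hsum.trans h1)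
      exact not_isHeraldedCNOT_single A γ j k h
  exact ⟨hsum ▸ hm, hm⟩

end Impossibility

theorem mainTheorem5 :
    (¬ ∃ (A : Matrix (Fin 4 ⊕ Fin 1) (Fin 4 ⊕ Fin 1) ℂ) (γ : ℂ),
        IsHeraldedCNOT A γ (fun _ => 1) (fun _ => 1)) ∧
    (∀ γ : ℂ, HasNullstellensatzCertificate (cnotSystem γ) 6) ∧
    (∀ (M : ℕ) (A : Matrix (Fin 4 ⊕ Fin M) (Fin 4 ⊕ Fin M) ℂ) (γ : ℂ) (anc m : Fin M → ℕ),
        IsHeraldedCNOT A γ anc m → 2 ≤ ∑ j, anc j ∧ 2 ≤ ∑ j, m j) := by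
  exact ⟨fun ⟨A, γ, h⟩ => not_isHeraldedCNOT_one A γ h, hasNullstellensatzCertificate_cnotSystem,
    fun _ _ _ _ _ h => two_le_of_isHeraldedCNOT h⟩
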